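/- Let $d\ge 1$, let $Q\subseteq\mathbb{R}^d$ and let $\gamma>0$. Let $B_1^d(1)=\{u\in\mathbb{R}^d:\|u\|_1\le 1\}$ and $S_1^d(1)=\{e\in\mathbb{R}^d:\|e\|_1=1\}$. Let $f$ be a real-valued function that is $M_2$-Lipschitz with respect to the Euclidean norm, $|f(y)-f(x)|\le M_2\|y-x\|_2$, on an open set $U\subseteq\mathbb{R}^d$ containing $x+\gamma B_1^d(1)$ for every $x\in Q$ (for example $U=\mathbb{R}^d$). Let $p\in[1,2]$ and let $q\in[2,\infty]$ satisfy $1/p+1/q=1$. Define $$\tilde f_\gamma(x)=\mathbb{E}_{\tilde u}\, f(x+\gamma\tilde u),\qquad \nabla\tilde f_\gamma(x,\tilde e)=d\,\frac{f(x+\gamma\tilde e)-f(x-\gamma\tilde e)}{2\gamma}\,\operatorname{sign}(\tilde e),$$ where $\tilde u$ is uniformly distributed on $B_1^d(1)$, $\tilde e$ is uniformly distributed (with respect to surface measure) on $S_1^d(1)$, and $\operatorname{sign}$ acts componentwise. Then for every $x\in Q$: 1. $\tilde f_\gamma$ is differentiable at $x$, and $\nabla\tilde f_\gamma(x,\tilde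 e)$ is an unbiased estimator of its gradient: $\mathbb{E}_{\tilde e}\left[\nabla\tilde f_\gamma(x,\tilde e)\right]=\nabla\tilde f_\gamma(x)$; 2. $\mathbb{E}_{\tilde e}\left[\|\nabla\tilde f_\gamma(x,\tilde e)\|_q^2\right]\le 288\,d^{2/q}M_2^2$, where $2/q=0$ if $q=\infty$. -/

import Mathlib

open MeasureTheory
open scoped ENNReal NNReal

noncomputable section

/-- The `ℓ_q` norm of a vector of `ℝ^d`, for `q ∈ [1, ∞]`. -/
def lqNorm {d : ℕ} (q : ℝ≥0∞) (v : EuclideanSpace ℝ (Fin d)) : ℝ :=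
  ‖WithLp.toLp q (fun i => v i)‖

/-- The closed unit ball of `ℝ^d` in the `ℓ_1` norm. -/
def l1Ball (d : ℕ) : Set (EuclideanSpace ℝ (Fin d)) := {u | ∑ i, |u i| ≤ 1}

/-- The unit sphere of `ℝ^d` in the `ℓ_1` norm. -/
def l1Sphere (d : ℕ) : Set (EuclideanSpace ℝ (Fin d)) := {e | ∑ i, |e i| = 1}

/-- The uniform distribution on the `ℓ_1` unit ball: normalized Lebesgue measure. -/
def uniformL1Ball (d : ℕ) : Measure (EuclideanSpace ℝ (Fin d)) :=
  ProbabilityTheory.cond volume (l1Ball d)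

/-- The uniform distribution on the `ℓ_1` unit sphere: normalized surface measure, that is, the
`(d - 1)`-dimensional Hausdorff measure (for the Euclidean metric) of the sphere, normalized. -/
def uniformL1Sphere (d : ℕ) : Measure (EuclideanSpace ℝ (Fin d)) :=
  ProbabilityTheory.cond (Measure.hausdorffMeasure ((d : ℝ) - 1)) (l1Sphere d)

/-- The smoothed function `x ↦ 𝔼 f (x + γ u)`, with `u` uniform on the `ℓ_1` unit ball. -/
def l1Smoothing {d : ℕ} (f : EuclideanSpace ℝ (Fin d) → ℝ) (γ : ℝ)
    (x : EuclideanSpace ℝ (Fin d)) : ℝ :=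
  ∫ u, f (x + γ • u) ∂(uniformL1Ball d)

/-- The componentwise sign of a vector. -/
def signVec {d : ℕ} (e : EuclideanSpace ℝ (Fin d)) : EuclideanSpace ℝ (Fin d) :=
  WithLp.toLp 2 (fun i => Real.sign (e i))

/-- The two-point gradient estimator `d (f (x + γ e) - f (x - γ e)) / (2 γ) sign e`. -/
def l1GradEstimator {d : ℕ} (f : EuclideanSpace ℝ (Fin d) → ℝ) (γ : ℝ)
    (x e : EuclideanSpace ℝ (Fin d)) : EuclideanSpace ℝ (Fin d) :=
  ((d : ℝ) * ((f (x + γ • e) - f (x - γ • e)) / (2 * γ))) • signVec e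

end

open Set Filter Topology

/-! Both claims are proved for a globally Lipschitz `F` and then transferred to `f`. A real-valued
Lipschitz function on `U` extends with the same constant, and since the ℓ₁ ball is compact and `U`
is open, the smoothings of `f` and `F` agree near `x`.

Unbiasedness is the divergence theorem. Differentiating under the integral (Rademacher plus
Lipschitz domination), the derivative of the smoothing is the average of the derivative of `F` over
the ball. The outward normal of the ℓ₁ ball is proportional to the sign vector, so
`LipschitzWith.setIntegral_l1Ball_lineDeriv` turns this average into `d / γ` times the spherical
mean of `sign θ * F (x + γ θ)`; symmetrizing under `θ ↦ -θ` gives the two-point estimator.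

The second moment reduces to a bound `72 L² / d²` for the mean square of an odd `L`-Lipschitz `g` on
the ℓ₁ sphere, applied to the symmetric difference of `F`, where `L = 2 M₂ γ`. The model is the
product of Laplace distributions: its density depends only on the ℓ₁ norm, so its direction is
uniform on the sphere and independent of its radius. It satisfies a Poincaré inequality with
constant 4, by an elementary one-dimensional argument and Efron–Stein tensorization. This is applied
to the 1-homogeneous extension `H` of `g`, which is odd and hence has mean zero, while its second
moment is `d (d + 1)` times that of `g`.

The gradient of `H` at `w` is at most `L (1 + 2 √d ‖w‖₂ / ‖w‖₁)`. The mean square of the ratio is `2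
/ (d + 1)`, so the expected squared gradient is at most `18 L²`, uniformly in `d`. Poincaré then
gives `72 L² / (d (d + 1))`. -/

/-! ### The Poincaré inequality for the Laplace distribution. -/

theorem integrableOn_sq_mul_exp_neg_Ioi :
    IntegrableOn (fun x : ℝ => x ^ 2 * Real.exp (-x)) (Ioi 0) := by
  have h := Real.GammaIntegral_convergent (s := 3) (by norm_num)
  refine h.congr_fun (fun x _ => ?_) measurableSet_Ioi
  have : (3 : ℝ) - 1 = (2 : ℕ) := by norm_num
  simp only [this, Real.rpow_natCast, mul_comm]

theorem LipschitzWith.abs_le_mul_abs {K : ℝ≥0} {u : ℝ → ℝ} (hu : LipschitzWith K u)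
    (h0 : u 0 = 0) (x : ℝ) : |u x| ≤ K * |x| := by
  simpa [Real.dist_eq, h0] using hu.dist_le_mul x 0

theorem LipschitzWith.deriv_sq_le {K : ℝ≥0} {u : ℝ → ℝ} (hu : LipschitzWith K u) (x : ℝ) :
    deriv u x ^ 2 ≤ (K : ℝ) ^ 2 := by
  have h : ‖deriv u x‖ ≤ K := norm_deriv_le_of_lipschitz hu
  exact sq_le_sq.2 (by simpa using h)

/-- A one-sided Poincaré inequality for the exponential weight. -/
theorem LipschitzWith.setIntegral_sq_mul_exp_neg_le {K : ℝ≥0} {u : ℝ → ℝ}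
    (hu : LipschitzWith K u) (h0 : u 0 = 0) :
    IntegrableOn (fun x => u x ^ 2 * Real.exp (-x)) (Ioi 0) ∧
    IntegrableOn (fun x => deriv u x ^ 2 * Real.exp (-x)) (Ioi 0) ∧
    ∫ x in Ioi 0, u x ^ 2 * Real.exp (-x) ≤ 4 * ∫ x in Ioi 0, deriv u x ^ 2 * Real.exp (-x) := by
  have hi1 : IntegrableOn (fun x => u x ^ 2 * Real.exp (-x)) (Ioi 0) := by
    refine (integrableOn_sq_mul_exp_neg_Ioi.const_mul ((K : ℝ) ^ 2)).mono'
      ((hu.continuous.pow 2).mul (by fun_prop)).aestronglyMeasurable (ae_of_all _ fun x => ?_)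
    have h1 := hu.abs_le_mul_abs h0 x
    have h2 : u x ^ 2 ≤ (K : ℝ) ^ 2 * x ^ 2 := by
      rw [← sq_abs, ← sq_abs x, ← mul_pow]
      gcongr
    rw [Real.norm_of_nonneg (by positivity), ← mul_assoc]
    gcongr
  have hi2 : IntegrableOn (fun x => deriv u x ^ 2 * Real.exp (-x)) (Ioi 0) := by
    refine ((integrableOn_exp_neg_Ioi 0).const_mul ((K : ℝ) ^ 2)).mono'
      (((measurable_deriv u).pow_const 2).mul (by fun_prop)).aestronglyMeasurable
      (ae_of_all _ fun x => ?_)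
    rw [Real.norm_of_nonneg (by positivity)]
    exact mul_le_mul_of_nonneg_right (hu.deriv_sq_le x) (Real.exp_nonneg _)
  refine ⟨hi1, hi2, ?_⟩
  -- Integrate `(u²)' e^{-x}` by parts on `[0, T]` and use `2 u u' ≤ u² / 2 + 2 u'²`; half of the
  -- left side is absorbed, which produces the factor 4.
  have key : ∀ T : ℝ, 0 ≤ T → ∫ x in (0 : ℝ)..T, u x ^ 2 * Real.exp (-x) ≤
      4 * ∫ x in (0 : ℝ)..T, deriv u x ^ 2 * Real.exp (-x) := by
    intro T hT
    have hac : AbsolutelyContinuousOnInterval u 0 T :=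
      (hu.lipschitzOnWith (s := uIcc 0 T)).absolutelyContinuousOnInterval
    have hac2 : AbsolutelyContinuousOnInterval (fun x => u x * u x) 0 T := hac.fun_mul hac
    have hexp : AbsolutelyContinuousOnInterval (fun x => Real.exp (-x)) 0 T :=
      ContDiffOn.absolutelyContinuousOnInterval (by fun_prop)
    have hsub : uIoc 0 T ⊆ Ioi 0 := by
      rw [uIoc_of_le hT]; exact Ioc_subset_Ioi_self
    have j1 : IntervalIntegrable (fun x => u x ^ 2 * Real.exp (-x)) volume 0 T :=
      intervalIntegrable_iff.2 (hi1.mono_set hsub)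
    have j2 : IntervalIntegrable (fun x => deriv u x ^ 2 * Real.exp (-x)) volume 0 T :=
      intervalIntegrable_iff.2 (hi2.mono_set hsub)
    have ibp := hac2.integral_mul_deriv_eq_deriv_mul hexp
    have hd : ∀ x : ℝ, deriv (fun x => Real.exp (-x)) x = -Real.exp (-x) := by
      intro x
      simpa using ((hasDerivAt_neg x).exp).deriv
    have j3 : IntervalIntegrable (fun x => deriv (fun x => u x * u x) x * Real.exp (-x))
        volume 0 T := hac2.intervalIntegrable_deriv.mul_continuousOn hexp.continuousOn
    have hmono : ∫ x in (0 : ℝ)..T, deriv (fun x => u x * u x) x * Real.exp (-x) ≤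
        ∫ x in (0 : ℝ)..T, (1 / 2 * (u x ^ 2 * Real.exp (-x))
          + 2 * (deriv u x ^ 2 * Real.exp (-x))) := by
      refine intervalIntegral.integral_mono_ae hT j3
        ((j1.const_mul _).add (j2.const_mul _)) ?_
      filter_upwards [hu.ae_differentiableAt (μ := volume)] with x hx
      rw [(hx.hasDerivAt.fun_mul hx.hasDerivAt).deriv]
      have := mul_nonneg (sq_nonneg (u x - 2 * deriv u x)) (Real.exp_nonneg (-x))
      nlinarith
    rw [intervalIntegral.integral_add (j1.const_mul _) (j2.const_mul _),
      intervalIntegral.integral_const_mul, intervalIntegral.integral_const_mul] at hmono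
    have hl : ∫ x in (0 : ℝ)..T, u x * u x * deriv (fun x => Real.exp (-x)) x =
        -∫ x in (0 : ℝ)..T, u x ^ 2 * Real.exp (-x) := by
      rw [← intervalIntegral.integral_neg]
      congr 1
      ext x
      rw [hd]; ring
    rw [hl] at ibp
    -- The boundary term at `T` has the favourable sign and is dropped; the one at `0` vanishes
    -- because `u 0 = 0`.
    have : 0 ≤ u T * u T * Real.exp (-T) := mul_nonneg (mul_self_nonneg _) (Real.exp_nonneg _)
    simp only [h0] at ibp
    linarith
  have t1 := intervalIntegral_tendsto_integral_Ioi 0 hi1 tendsto_id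
  have t2 := (intervalIntegral_tendsto_integral_Ioi 0 hi2 tendsto_id).const_mul 4
  refine le_of_tendsto_of_tendsto t1 t2 ?_
  filter_upwards [eventually_ge_atTop 0] with T hT using key T hT

/-- The Laplace (two-sided exponential) distribution on `ℝ`. -/
noncomputable def laplaceMeasure : Measure ℝ :=
  volume.withDensity (fun x => ENNReal.ofReal (Real.exp (-|x|) / 2))

theorem integrable_laplaceMeasure_iff {g : ℝ → ℝ} :
    Integrable g laplaceMeasure ↔ Integrable (fun x => Real.exp (-|x|) / 2 * g x) := by
  rw [laplaceMeasure, integrable_withDensity_iff_integrable_smul₀' (by fun_prop) (by simp)]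
  refine integrable_congr (ae_of_all _ fun x => ?_)
  simp [ENNReal.toReal_ofReal (show 0 ≤ Real.exp (-|x|) / 2 by positivity)]

theorem integral_laplaceMeasure (g : ℝ → ℝ) :
    ∫ x, g x ∂laplaceMeasure = ∫ x, Real.exp (-|x|) / 2 * g x := by
  rw [laplaceMeasure, integral_withDensity_eq_integral_toReal_smul (by fun_prop) (by simp)]
  refine integral_congr_ae (ae_of_all _ fun x => ?_)
  simp [ENNReal.toReal_ofReal (show 0 ≤ Real.exp (-|x|) / 2 by positivity)]

theorem integrable_of_integrableOn_Ioi_comp_neg {h : ℝ → ℝ} (h1 : IntegrableOn h (Ioi 0))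
    (h2 : IntegrableOn (fun x => h (-x)) (Ioi 0)) :
    Integrable h ∧ ∫ x, h x = (∫ x in Ioi 0, h x) + ∫ x in Ioi 0, h (-x) := by
  have h3 : IntegrableOn h (Iic 0) := by
    have := (Measure.measurePreserving_neg (volume : Measure ℝ)).integrableOn_comp_preimage
      (Homeomorph.neg ℝ).measurableEmbedding (f := h) (s := Iio 0)
    rw [integrableOn_Iic_iff_integrableOn_Iio]
    apply this.1
    simpa [Function.comp_def] using h2
  refine ⟨?_, ?_⟩
  · rw [← integrableOn_univ, ← Iic_union_Ioi (a := (0 : ℝ))]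
    exact h3.union h1
  · rw [integral_comp_neg_Ioi, neg_zero, add_comm,
      ← setIntegral_union (Iic_disjoint_Ioi le_rfl) measurableSet_Ioi h3 h1, Iic_union_Ioi,
      Measure.restrict_univ]

theorem integral_laplaceMeasure_eq {g : ℝ → ℝ}
    (h1 : IntegrableOn (fun x => g x * Real.exp (-x)) (Ioi 0))
    (h2 : IntegrableOn (fun x => g (-x) * Real.exp (-x)) (Ioi 0)) :
    Integrable g laplaceMeasure ∧ ∫ x, g x ∂laplaceMeasure =
      ((∫ x in Ioi 0, g x * Real.exp (-x)) + ∫ x in Ioi 0, g (-x) * Real.exp (-x)) / 2 := by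
  rw [integrable_laplaceMeasure_iff, integral_laplaceMeasure]
  have e1 : ∀ x ∈ Ioi (0 : ℝ), g x * Real.exp (-x) / 2 = Real.exp (-|x|) / 2 * g x := by
    intro x hx
    rw [abs_of_pos hx]; ring
  have e2 : ∀ x ∈ Ioi (0 : ℝ), g (-x) * Real.exp (-x) / 2 = Real.exp (-|-x|) / 2 * g (-x) := by
    intro x hx
    rw [abs_neg, abs_of_pos hx]; ring
  have := integrable_of_integrableOn_Ioi_comp_neg (h := fun x => Real.exp (-|x|) / 2 * g x)
    (IntegrableOn.congr_fun (Integrable.div_const h1 2) e1 measurableSet_Ioi)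
    (IntegrableOn.congr_fun (Integrable.div_const h2 2) e2 measurableSet_Ioi)
  refine ⟨this.1, this.2.trans ?_⟩
  rw [← setIntegral_congr_fun measurableSet_Ioi e1, ← setIntegral_congr_fun measurableSet_Ioi e2,
    integral_div, integral_div]
  ring

instance : IsProbabilityMeasure laplaceMeasure := by
  have h := integral_laplaceMeasure_eq (g := fun _ => 1)
    (by simpa using integrableOn_exp_neg_Ioi 0) (by simpa using integrableOn_exp_neg_Ioi 0)
  have hf : IsFiniteMeasure laplaceMeasure := by
    have := h.1
    rw [integrable_const_iff] at this
    simpa using this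
  constructor
  have h2 := h.2
  simp only [one_mul, integral_exp_neg_Ioi_zero, integral_const, smul_eq_mul, mul_one] at h2
  rw [← ENNReal.ofReal_toReal (measure_ne_top laplaceMeasure univ)]
  have : (laplaceMeasure univ).toReal = 1 := by
    rw [← Measure.real]; rw [h2]; norm_num
  rw [this, ENNReal.ofReal_one]

theorem integrable_sq_laplaceMeasure : Integrable (fun x : ℝ => x ^ 2) laplaceMeasure :=
  (integral_laplaceMeasure_eq (by simpa using integrableOn_sq_mul_exp_neg_Ioi)
    (by simpa using integrableOn_sq_mul_exp_neg_Ioi)).1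

theorem LipschitzWith.memLp_laplaceMeasure {K : ℝ≥0} {u : ℝ → ℝ} (hu : LipschitzWith K u) :
    MemLp u 2 laplaceMeasure := by
  have h : MemLp (fun x => u x - u 0) 2 laplaceMeasure := by
    have hx : MemLp (fun x : ℝ => x) 2 laplaceMeasure :=
      (memLp_two_iff_integrable_sq aestronglyMeasurable_id).2 integrable_sq_laplaceMeasure
    refine (hx.const_mul (K : ℝ)).mono (hu.continuous.sub continuous_const).aestronglyMeasurable
      (ae_of_all _ fun x => ?_)
    simpa [Real.dist_eq] using hu.dist_le_mul x 0
  have := h.add (memLp_const (u 0))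
  convert this using 1
  ext x
  simp

/-- The Poincaré inequality for the Laplace distribution. -/
theorem LipschitzWith.integral_sq_sub_sq_integral_laplaceMeasure_le {K : ℝ≥0} {u : ℝ → ℝ}
    (hu : LipschitzWith K u) :
    ∫ x, u x ^ 2 ∂laplaceMeasure - (∫ x, u x ∂laplaceMeasure) ^ 2 ≤
      4 * ∫ x, deriv u x ^ 2 ∂laplaceMeasure := by
  set a := u 0
  have hv : LipschitzWith K (fun x => u x - a) :=
    LipschitzWith.of_dist_le_mul fun x y => by simpa using hu.dist_le_mul x y
  have hw : LipschitzWith K (fun x => u (-x) - a) :=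
    LipschitzWith.of_dist_le_mul fun x y => by simpa using hu.dist_le_mul (-x) (-y)
  obtain ⟨v1, v2, v3⟩ := hv.setIntegral_sq_mul_exp_neg_le (by simp [a])
  obtain ⟨w1, w2, w3⟩ := hw.setIntegral_sq_mul_exp_neg_le (by simp [a])
  have d1 : ∀ x, deriv (fun x => u x - a) x = deriv u x := fun x => by simp
  have d2 : ∀ x, deriv (fun x => u (-x) - a) x ^ 2 = deriv u (-x) ^ 2 := fun x => by
    rw [deriv_sub_const, deriv_comp_neg]; ring
  simp only [d1, d2] at v2 v3 w2 w3
  have e1 := integral_laplaceMeasure_eq (g := fun x => (u x - a) ^ 2) v1 w1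
  have e2 := integral_laplaceMeasure_eq (g := fun x => deriv u x ^ 2) v2 w2
  have hL := hu.memLp_laplaceMeasure
  have hi := hL.integrable (by norm_num)
  have hi2 := hL.integrable_sq
  have e3 : ∫ x, (u x - a) ^ 2 ∂laplaceMeasure =
      ∫ x, u x ^ 2 ∂laplaceMeasure - 2 * a * (∫ x, u x ∂laplaceMeasure) + a ^ 2 := by
    have : ∀ x, (u x - a) ^ 2 = u x ^ 2 - 2 * a * u x + a ^ 2 := fun x => by ring
    simp_rw [this]
    have i1 : Integrable (fun x => 2 * a * u x) laplaceMeasure := hi.const_mul _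
    have i2 : Integrable (fun x => u x ^ 2 - 2 * a * u x) laplaceMeasure := hi2.sub i1
    rw [integral_add i2 (integrable_const _), integral_sub hi2 i1, integral_const_mul]
    simp
  have := e1.2
  have := e2.2
  -- The variance is at most the second moment about any point, here about `a = u 0`, where both
  -- half-line inequalities apply.
  nlinarith [sq_nonneg ((∫ x, u x ∂laplaceMeasure) - a)]

/-! ### Efron–Stein for two independent factors. -/

theorem MeasureTheory.MemLp.sq_integral_le {X : Type*} [MeasurableSpace X] {μ : Measure X}
    [IsProbabilityMeasure μ] {g : X → ℝ} (hg : MemLp g 2 μ) :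
    (∫ x, g x ∂μ) ^ 2 ≤ ∫ x, g x ^ 2 ∂μ := by
  have h := ProbabilityTheory.variance_nonneg g μ
  rw [ProbabilityTheory.variance_eq_sub hg] at h
  simpa using h

section TwoFactors

variable {X Y : Type*} [MeasurableSpace X] [MeasurableSpace Y] {μ : Measure X} {ν : Measure Y}
  [IsProbabilityMeasure μ] [IsProbabilityMeasure ν] {F : X × Y → ℝ}

theorem MeasureTheory.MemLp.ae_memLp_prod (hF : MemLp F 2 (μ.prod ν)) :
    ∀ᵐ x ∂μ, MemLp (fun y => F (x, y)) 2 ν := by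
  filter_upwards [hF.aestronglyMeasurable.prodMk_left, hF.integrable_sq.prod_right_ae]
    with x h1 h2
  exact (memLp_two_iff_integrable_sq h1).2 h2

theorem MeasureTheory.MemLp.integral_prod_left_two (hF : MemLp F 2 (μ.prod ν)) :
    MemLp (fun x => ∫ y, F (x, y) ∂ν) 2 μ := by
  refine (memLp_two_iff_integrable_sq hF.aestronglyMeasurable.integral_prod_right').2 ?_
  refine hF.integrable_sq.integral_prod_left.mono'
    (hF.aestronglyMeasurable.integral_prod_right'.pow 2) ?_
  filter_upwards [hF.ae_memLp_prod] with x hx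
  rw [Real.norm_of_nonneg (sq_nonneg _)]
  exact hx.sq_integral_le

/-- The Efron–Stein inequality for two factors. -/
theorem MeasureTheory.MemLp.efron_stein_prod (hF : MemLp F 2 (μ.prod ν)) :
    ∫ z, F z ^ 2 ∂(μ.prod ν) - (∫ z, F z ∂(μ.prod ν)) ^ 2 ≤
      (∫ z, F z ^ 2 ∂(μ.prod ν) - ∫ y, (∫ x, F (x, y) ∂μ) ^ 2 ∂ν) +
      (∫ z, F z ^ 2 ∂(μ.prod ν) - ∫ x, (∫ y, F (x, y) ∂ν) ^ 2 ∂μ) := by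
  set a : X → ℝ := fun x => ∫ y, F (x, y) ∂ν with ha
  set b : Y → ℝ := fun y => ∫ x, F (x, y) ∂μ with hb
  set m : ℝ := ∫ z, F z ∂(μ.prod ν) with hm
  have hFi : Integrable F (μ.prod ν) := hF.integrable (by norm_num)
  have La : MemLp a 2 μ := hF.integral_prod_left_two
  have Lb : MemLp b 2 ν := (hF.comp_measurePreserving
    (Measure.measurePreserving_swap (μ := ν) (ν := μ))).integral_prod_left_two
  have La' : MemLp (fun z : X × Y => a z.1) 2 (μ.prod ν) :=
    La.comp_measurePreserving measurePreserving_fst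
  have Lb' : MemLp (fun z : X × Y => b z.2) 2 (μ.prod ν) :=
    Lb.comp_measurePreserving measurePreserving_snd
  have ia := La.integrable (q := 2) (by norm_num)
  have ib := Lb.integrable (q := 2) (by norm_num)
  have ma : ∫ x, a x ∂μ = m := (integral_prod F hFi).symm
  have mb : ∫ y, b y ∂ν = m := (integral_prod_symm F hFi).symm
  have iFa : Integrable (fun z => F z * a z.1) (μ.prod ν) := hF.integrable_mul La'
  have iFb : Integrable (fun z => F z * b z.2) (μ.prod ν) := hF.integrable_mul Lb'
  have iab : Integrable (fun z : X × Y => a z.1 * b z.2) (μ.prod ν) := La'.integrable_mul Lb'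
  have iF2 := hF.integrable_sq
  have ia2 := La'.integrable_sq
  have ib2 := Lb'.integrable_sq
  have ia1 : Integrable (fun z : X × Y => a z.1) (μ.prod ν) := La'.integrable (by norm_num)
  have ib1 : Integrable (fun z : X × Y => b z.2) (μ.prod ν) := Lb'.integrable (by norm_num)
  have eFa : ∫ z, F z * a z.1 ∂(μ.prod ν) = ∫ x, a x ^ 2 ∂μ := by
    rw [integral_prod _ iFa]
    simp_rw [integral_mul_const, sq]
    rfl
  have eFb : ∫ z, F z * b z.2 ∂(μ.prod ν) = ∫ y, b y ^ 2 ∂ν := by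
    rw [integral_prod_symm _ iFb]
    simp_rw [integral_mul_const, sq]
    rfl
  have eab : ∫ z : X × Y, a z.1 * b z.2 ∂(μ.prod ν) = m * m := by
    rw [integral_prod_mul, ma, mb]
  have ea2 : ∫ z : X × Y, a z.1 ^ 2 ∂(μ.prod ν) = ∫ x, a x ^ 2 ∂μ := by
    rw [integral_prod _ ia2]; simp
  have eb2 : ∫ z : X × Y, b z.2 ^ 2 ∂(μ.prod ν) = ∫ y, b y ^ 2 ∂ν := by
    rw [integral_prod_symm _ ib2]; simp
  have ea1 : ∫ z : X × Y, a z.1 ∂(μ.prod ν) = m := by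
    rw [integral_prod _ ia1]; simpa using ma
  have eb1 : ∫ z : X × Y, b z.2 ∂(μ.prod ν) = m := by
    rw [integral_prod_symm _ ib1]; simpa using mb
  -- Opaque names for the two marginals as functions on the product, so that `fun_prop` can match
  -- the integrability hypotheses.
  obtain ⟨A, hA⟩ : ∃ A : X × Y → ℝ, ∀ z, a z.1 = A z := ⟨_, fun _ => rfl⟩
  obtain ⟨B, hB⟩ : ∃ B : X × Y → ℝ, ∀ z, b z.2 = B z := ⟨_, fun _ => rfl⟩
  -- `F - a - b + m` is the interaction part of `F`. Its squared norm expands to `∫F² - ∫a² - ∫b² +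
  -- m²`, and nonnegativity of this is the claim.
  have h0 : 0 ≤ ∫ z : X × Y, (F z - a z.1 - b z.2 + m) ^ 2 ∂(μ.prod ν) :=
    integral_nonneg fun z => sq_nonneg _
  have hexp : ∀ z : X × Y, (F z - a z.1 - b z.2 + m) ^ 2 =
      F z ^ 2 + a z.1 ^ 2 + b z.2 ^ 2 + (-2) * (F z * a z.1) + (-2) * (F z * b z.2)
        + 2 * (a z.1 * b z.2) + (2 * m) * F z + (-(2 * m)) * a z.1 + (-(2 * m)) * b z.2
        + m ^ 2 := fun z => by ring
  simp_rw [hexp] at h0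
  simp only [hA, hB] at *
  rw [integral_add (by fun_prop) (by fun_prop), integral_add (by fun_prop) (by fun_prop),
    integral_add (by fun_prop) (by fun_prop), integral_add (by fun_prop) (by fun_prop),
    integral_add (by fun_prop) (by fun_prop), integral_add (by fun_prop) (by fun_prop),
    integral_add (by fun_prop) (by fun_prop), integral_add (by fun_prop) (by fun_prop),
    integral_add (by fun_prop) (by fun_prop)] at h0
  simp only [integral_const_mul, eFa, eFb, eab, ea2, eb2, ea1, eb1, integral_const, ← hm,
    smul_eq_mul, probReal_univ] at h0
  nlinarith

end TwoFactors

/-! ### Products of Laplace distributions and tensorization. -/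

theorem coe_piFinSuccAbove_symm_zero (n : ℕ) :
    ⇑(MeasurableEquiv.piFinSuccAbove (fun _ : Fin (n + 1) => ℝ) 0).symm =
      fun z : ℝ × (Fin n → ℝ) => (Fin.cons z.1 z.2 : Fin (n + 1) → ℝ) := by
  ext z i
  refine Fin.cases ?_ (fun j => ?_) i <;> simp [MeasurableEquiv.piFinSuccAbove]

/-- The product of `n` Laplace distributions. -/
noncomputable def laplacePi (n : ℕ) : Measure (Fin n → ℝ) :=
  Measure.pi fun _ => laplaceMeasure

instance (n : ℕ) : IsProbabilityMeasure (laplacePi n) := by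
  unfold laplacePi; infer_instance

theorem measurePreserving_cons_laplacePi (n : ℕ) :
    MeasurePreserving (fun z : ℝ × (Fin n → ℝ) => (Fin.cons z.1 z.2 : Fin (n + 1) → ℝ))
      (laplaceMeasure.prod (laplacePi n)) (laplacePi (n + 1)) := by
  have := (measurePreserving_piFinSuccAbove (fun _ : Fin (n + 1) => laplaceMeasure) 0).symm
  rwa [coe_piFinSuccAbove_symm_zero] at this

theorem measurePreserving_cons_volume (n : ℕ) :
    MeasurePreserving (fun z : ℝ × (Fin n → ℝ) => (Fin.cons z.1 z.2 : Fin (n + 1) → ℝ)) := by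
  have := (volume_preserving_piFinSuccAbove (fun _ : Fin (n + 1) => ℝ) 0).symm
  rwa [coe_piFinSuccAbove_symm_zero] at this

/-- The product of the one-dimensional densities is a function of the ℓ₁ norm alone, which is what
links this measure to the ℓ₁ sphere. -/
theorem laplacePi_eq_withDensity (n : ℕ) :
    laplacePi n = (volume : Measure (Fin n → ℝ)).withDensity
      (fun w => ENNReal.ofReal (Real.exp (-∑ i, |w i|) / 2 ^ n)) := by
  induction n with
  | zero =>
    rw [laplacePi, Measure.pi_of_empty, volume_pi, Measure.pi_of_empty (x := isEmptyElim)]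
    simp
  | succ n ih =>
    have h1 := (measurePreserving_cons_laplacePi n).map_eq
    have h2 := (measurePreserving_cons_volume n)
    rw [← h1, ih, laplaceMeasure, prod_withDensity (by fun_prop) (by fun_prop)]
    ext s hs
    rw [Measure.map_apply h2.measurable hs, withDensity_apply _ (h2.measurable hs),
      withDensity_apply _ hs]
    have := h2.setLIntegral_comp_preimage hs (f := fun w => ENNReal.ofReal
      (Real.exp (-∑ i, |w i|) / 2 ^ (n + 1))) (by fun_prop)
    rw [← this]
    refine lintegral_congr fun z => ?_
    rw [← ENNReal.ofReal_mul (by positivity), Fin.sum_univ_succ]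
    simp only [Fin.cons_zero, Fin.cons_succ, neg_add, Real.exp_add]
    congr 1
    field_simp
    ring

theorem LipschitzWith.memLp_laplacePi {n : ℕ} {K : ℝ≥0} {F : (Fin n → ℝ) → ℝ}
    (hF : LipschitzWith K F) : MemLp F 2 (laplacePi n) := by
  have hcoord : ∀ i : Fin n, MemLp (fun w : Fin n → ℝ => w i) 2 (laplacePi n) := fun i =>
    (memLp_two_iff_integrable_sq (measurable_pi_apply i).aestronglyMeasurable).2
      (integrable_comp_eval (μ := fun _ : Fin n => laplaceMeasure) (i := i)
        integrable_sq_laplaceMeasure)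
  have hsum : MemLp (fun w : Fin n → ℝ => ∑ i, |w i|) 2 (laplacePi n) :=
    memLp_finsetSum _ fun i _ => (hcoord i).norm
  have h : MemLp (fun x => F x - F 0) 2 (laplacePi n) := by
    refine (hsum.const_mul (K : ℝ)).mono (hF.continuous.sub continuous_const).aestronglyMeasurable
      (ae_of_all _ fun w => ?_)
    have h1 := hF.dist_le_mul w 0
    rw [Real.dist_eq, dist_zero_right] at h1
    have h2 : ‖w‖ ≤ ∑ i, |w i| :=
      (pi_norm_le_iff_of_nonneg (by positivity)).2 fun i =>
        Finset.single_le_sum (f := fun i => |w i|) (fun _ _ => abs_nonneg _) (Finset.mem_univ i)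
    rw [Real.norm_eq_abs, Real.norm_of_nonneg (by positivity)]
    exact h1.trans (by gcongr)
  have := h.add (memLp_const (F 0))
  convert this using 1
  ext x
  simp

theorem LipschitzWith.integrable_lineDeriv_sq {E : Type*} [NormedAddCommGroup E] [NormedSpace ℝ E]
    [FiniteDimensional ℝ E] [MeasurableSpace E] [BorelSpace E] {μ : Measure E} [IsFiniteMeasure μ]
    {K : ℝ≥0} {F : E → ℝ} (hF : LipschitzWith K F) (v : E) :
    Integrable (fun w => lineDeriv ℝ F w v ^ 2) μ := by
  refine Integrable.of_bound ((measurable_lineDeriv hF.continuous).pow_const 2).aestronglyMeasurable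
    ((K * ‖v‖) ^ 2) (ae_of_all _ fun w => ?_)
  rw [norm_pow]
  gcongr
  exact norm_lineDeriv_le_of_lipschitz ℝ hF

theorem lineDeriv_cons_single_zero {n : ℕ} (F : (Fin (n + 1) → ℝ) → ℝ) (x : ℝ) (y : Fin n → ℝ) :
    lineDeriv ℝ F (Fin.cons x y : Fin (n + 1) → ℝ) (Pi.single 0 1) =
      deriv (fun s => F (Fin.cons s y : Fin (n + 1) → ℝ)) x := by
  have : ∀ t : ℝ, (Fin.cons x y : Fin (n + 1) → ℝ) + t • (Pi.single 0 1 : Fin (n + 1) → ℝ) =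
      (Fin.cons (x + t) y : Fin (n + 1) → ℝ) := by
    intro t
    ext i
    refine Fin.cases ?_ (fun j => ?_) i <;> simp
  unfold lineDeriv
  simp_rw [this]
  rw [deriv_comp_const_add (f := fun s => F (Fin.cons s y : Fin (n + 1) → ℝ))]
  simp

theorem lineDeriv_cons_single_succ {n : ℕ} (F : (Fin (n + 1) → ℝ) → ℝ) (x : ℝ) (y : Fin n → ℝ)
    (i : Fin n) :
    lineDeriv ℝ F (Fin.cons x y : Fin (n + 1) → ℝ) (Pi.single i.succ 1) =
      lineDeriv ℝ (fun y => F (Fin.cons x y : Fin (n + 1) → ℝ)) y (Pi.single i 1) := by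
  have : ∀ t : ℝ, (Fin.cons x y : Fin (n + 1) → ℝ) + t • (Pi.single i.succ 1 : Fin (n + 1) → ℝ) =
      (Fin.cons x (y + t • (Pi.single i 1 : Fin n → ℝ)) : Fin (n + 1) → ℝ) := by
    intro t
    ext j
    refine Fin.cases ?_ (fun j => ?_) j
    · simp
    · by_cases h : j = i
      · subst h; simp
      · simp [Pi.single_eq_of_ne, h]
  unfold lineDeriv
  simp_rw [this]

/-- The Poincaré inequality for a product of Laplace distributions. -/
theorem LipschitzWith.poincare_laplacePi {n : ℕ} {K : ℝ≥0} {F : (Fin n → ℝ) → ℝ}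
    (hF : LipschitzWith K F) :
    ∫ w, F w ^ 2 ∂(laplacePi n) - (∫ w, F w ∂(laplacePi n)) ^ 2 ≤
      4 * ∑ i, ∫ w, lineDeriv ℝ F w (Pi.single i 1) ^ 2 ∂(laplacePi n) := by
  induction n with
  | zero =>
    have h : ∀ w, F w = F 0 := fun w => by rw [Subsingleton.elim w 0]
    simp_rw [h]
    simp
  | succ n ih =>
    have mp := measurePreserving_cons_laplacePi n
    set μ := laplaceMeasure
    set ν := laplacePi n
    set G : ℝ × (Fin n → ℝ) → ℝ := fun z => F (Fin.cons z.1 z.2) with hG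
    have emb : MeasurableEmbedding
        (fun z : ℝ × (Fin n → ℝ) => (Fin.cons z.1 z.2 : Fin (n + 1) → ℝ)) := by
      have := (MeasurableEquiv.piFinSuccAbove (fun _ : Fin (n + 1) => ℝ) 0).symm.measurableEmbedding
      rwa [coe_piFinSuccAbove_symm_zero] at this
    have L2 : MemLp G 2 (μ.prod ν) := hF.memLp_laplacePi.comp_measurePreserving mp
    have hx : ∀ x, LipschitzWith K (fun y : Fin n → ℝ => F (Fin.cons x y : Fin (n + 1) → ℝ)) := by
      intro x
      refine LipschitzWith.of_dist_le_mul fun y y' => (hF.dist_le_mul _ _).trans ?_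
      gcongr
      refine (dist_pi_le_iff dist_nonneg).2 fun i => ?_
      refine Fin.cases (by simp) (fun j => ?_) i
      simpa using dist_le_pi_dist y y' j
    have hy : ∀ y : Fin n → ℝ, LipschitzWith K (fun x => F (Fin.cons x y : Fin (n + 1) → ℝ)) := by
      intro y
      refine LipschitzWith.of_dist_le_mul fun x x' => (hF.dist_le_mul _ _).trans ?_
      gcongr
      refine (dist_pi_le_iff dist_nonneg).2 fun i => ?_
      refine Fin.cases (by simp) (fun j => ?_) i
      simp
    have hD : ∀ i : Fin (n + 1), Integrable
        (fun z : ℝ × (Fin n → ℝ) => lineDeriv ℝ F (Fin.cons z.1 z.2) (Pi.single i 1) ^ 2)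
        (μ.prod ν) := fun i =>
      (mp.integrable_comp_emb emb).2 (hF.integrable_lineDeriv_sq (μ := laplacePi (n + 1)) _)
    have i2 := L2.integrable_sq
    have es := L2.efron_stein_prod
    have tr : ∀ H : (Fin (n + 1) → ℝ) → ℝ,
        ∫ w, H w ∂(laplacePi (n + 1)) = ∫ z, H (Fin.cons z.1 z.2) ∂(μ.prod ν) :=
      fun H => (mp.integral_comp emb H).symm
    simp_rw [tr]
    refine es.trans ?_
    have La := L2.integral_prod_left_two.integrable_sq
    have Lb : Integrable (fun y => (∫ x, G (x, y) ∂μ) ^ 2) ν := (L2.comp_measurePreserving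
      (Measure.measurePreserving_swap (μ := ν) (ν := μ))).integral_prod_left_two.integrable_sq
    rw [Fin.sum_univ_succ, mul_add]
    refine add_le_add ?_ ?_
    -- First Efron–Stein term: for fixed remaining coordinates it is a variance in the first
    -- coordinate, bounded by the one-dimensional inequality.
    · rw [integral_prod_symm _ i2, integral_prod_symm _ (hD 0), ← integral_sub
        i2.integral_prod_right Lb, ← integral_const_mul]
      refine integral_mono (i2.integral_prod_right.sub Lb)
        ((hD 0).integral_prod_right.const_mul 4) fun y => ?_
      simp only [hG, lineDeriv_cons_single_zero]
      exact (hy y).integral_sq_sub_sq_integral_laplaceMeasure_le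
    -- Second term: for a fixed first coordinate it is a variance in the other `n` coordinates,
    -- bounded by induction.
    · rw [← integral_finsetSum _ (fun i _ => hD i.succ)]
      have hS := integrable_finsetSum Finset.univ (fun i _ => hD (Fin.succ i))
      rw [integral_prod _ i2, integral_prod _ hS, ← integral_sub
        i2.integral_prod_left La, ← integral_const_mul]
      refine integral_mono (i2.integral_prod_left.sub La)
        (hS.integral_prod_left.const_mul 4) fun x => ?_
      simp only [hG, lineDeriv_cons_single_succ]
      rw [integral_finsetSum _ (fun i _ => (hx x).integrable_lineDeriv_sq _)]
      exact ih (hx x)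

/-! ### Slicing Lebesgue measure by the hyperplanes of constant coordinate sum. -/

/-- The sum of the coordinates. -/
noncomputable def coordSum (d : ℕ) : EuclideanSpace ℝ (Fin d) →ₗ[ℝ] ℝ where
  toFun e := ∑ i, e i
  map_add' := by intro x y; simp [Finset.sum_add_distrib]
  map_smul' := by intro c x; simp [Finset.mul_sum]

theorem coordSum_apply {d : ℕ} (e : EuclideanSpace ℝ (Fin d)) : coordSum d e = ∑ i, e i := rfl

theorem coordSum_single (n : ℕ) :
    coordSum (n + 1) (EuclideanSpace.single (0 : Fin (n + 1)) (1 : ℝ)) = 1 := by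
  simp [coordSum_apply]

theorem finrank_ker_coordSum (n : ℕ) :
    Module.finrank ℝ (LinearMap.ker (coordSum (n + 1))) = n := by
  have hr : LinearMap.range (coordSum (n + 1)) = ⊤ := by
    refine LinearMap.range_eq_top.2 fun t => ⟨t • EuclideanSpace.single 0 1, ?_⟩
    rw [map_smul, coordSum_single]; simp
  have := LinearMap.finrank_range_add_finrank_ker (coordSum (n + 1))
  rw [hr] at this
  simp at this
  omega

/-- Every vector is the sum of a vector with coordinate sum `0` and a multiple of the first
basis vector. -/
noncomputable def kerCoordSumProd (n : ℕ) :
    (LinearMap.ker (coordSum (n + 1)) × ℝ) ≃ₗ[ℝ] EuclideanSpace ℝ (Fin (n + 1)) where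
  toFun z := (z.1 : EuclideanSpace ℝ (Fin (n + 1))) + z.2 • EuclideanSpace.single 0 1
  invFun e := (⟨e - coordSum (n + 1) e • EuclideanSpace.single 0 1, by
    rw [LinearMap.mem_ker, map_sub, map_smul, coordSum_single]; simp⟩, coordSum (n + 1) e)
  left_inv := by
    rintro ⟨⟨v, hv⟩, t⟩
    rw [LinearMap.mem_ker] at hv
    have : coordSum (n + 1) (v + t • EuclideanSpace.single 0 1) = t := by
      rw [map_add, map_smul, coordSum_single, hv]; simp
    simp [this]
  right_inv := by intro e; simp
  map_add' := by
    rintro ⟨v, t⟩ ⟨w, s⟩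
    simp only [Prod.fst_add, Prod.snd_add, Submodule.coe_add, add_smul]
    abel
  map_smul' := by
    rintro c ⟨v, t⟩
    simp [smul_smul, smul_add]

instance isAddHaarMeasure_hausdorffMeasure_ker_coordSum (n : ℕ) :
    (μH[(n : ℝ)] : Measure (LinearMap.ker (coordSum (n + 1)))).IsAddHaarMeasure := by
  have := isAddHaarMeasure_hausdorffMeasure (E := LinearMap.ker (coordSum (n + 1)))
  rwa [finrank_ker_coordSum] at this

theorem isometry_coe_add (n : ℕ) :
    Isometry (fun v : LinearMap.ker (coordSum (n + 1)) =>
      (v : EuclideanSpace ℝ (Fin (n + 1))) + EuclideanSpace.single 0 1) :=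
  Isometry.of_dist_eq fun v w => by rw [dist_add_right]; rfl

theorem range_coe_add (n : ℕ) :
    range (fun v : LinearMap.ker (coordSum (n + 1)) =>
      (v : EuclideanSpace ℝ (Fin (n + 1))) + EuclideanSpace.single 0 1) =
      {e | coordSum (n + 1) e = 1} := by
  ext e
  constructor
  · rintro ⟨⟨v, hv⟩, rfl⟩
    rw [LinearMap.mem_ker] at hv
    rw [mem_ofPred_eq, map_add, coordSum_single, hv, zero_add]
  · intro he
    refine ⟨⟨e - EuclideanSpace.single 0 1, ?_⟩, by simp⟩
    rw [LinearMap.mem_ker, map_sub, coordSum_single, he, sub_self]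

/-- Translation by the first basis vector is an isometry of the kernel onto the affine hyperplane,
so the surface measure there is a copy of a Haar measure on an `n`-dimensional space. -/
theorem map_coe_add_hausdorffMeasure (n : ℕ) :
    Measure.map (fun v : LinearMap.ker (coordSum (n + 1)) =>
      (v : EuclideanSpace ℝ (Fin (n + 1))) + EuclideanSpace.single 0 1) μH[(n : ℝ)] =
      μH[(n : ℝ)].restrict {e | coordSum (n + 1) e = 1} := by
  rw [(isometry_coe_add n).map_hausdorffMeasure (Or.inl n.cast_nonneg), range_coe_add]

/-- The `n`-dimensional Hausdorff measure of the whole `(n + 1)`-dimensional space is not σ-finite;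
measurability of parametric integrals is available only after restriction to the hyperplane. -/
instance (n : ℕ) : SFinite
    ((μH[(n : ℝ)] : Measure (EuclideanSpace ℝ (Fin (n + 1)))).restrict
      {e | coordSum (n + 1) e = 1}) := by
  rw [← map_coe_add_hausdorffMeasure]
  infer_instance

theorem lintegral_haar_eq_mul_lintegral_smul {V : Type*} [NormedAddCommGroup V] [NormedSpace ℝ V]
    [FiniteDimensional ℝ V] [MeasurableSpace V] [BorelSpace V] (μ : Measure V)
    [μ.IsAddHaarMeasure] (f : V → ℝ≥0∞) {t : ℝ} (ht : 0 < t) :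
    ∫⁻ v, f v ∂μ = ENNReal.ofReal (t ^ Module.finrank ℝ V) * ∫⁻ v, f (t • v) ∂μ := by
  have h := Measure.map_addHaar_smul μ ht.ne'
  have h2 : ∫⁻ v, f (t • v) ∂μ = ∫⁻ v, f v ∂(Measure.map (t • ·) μ) :=
    ((Homeomorph.smulOfNeZero t ht.ne').measurableEmbedding.lintegral_map f).symm
  rw [h2, h, lintegral_smul_measure, smul_eq_mul, ← mul_assoc,
    ← ENNReal.ofReal_mul (by positivity), abs_of_pos (by positivity),
    mul_inv_cancel₀ (by positivity), ENNReal.ofReal_one, one_mul]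

/-- Polar-type integration over the half-space where the coordinate sum is positive. -/
theorem exists_lintegral_eq_lintegral_hyperplane (n : ℕ) : ∃ c : ℝ≥0∞, c ≠ 0 ∧ c ≠ ∞ ∧
    ∀ G : EuclideanSpace ℝ (Fin (n + 1)) → ℝ≥0∞, Measurable G →
      (∀ e, coordSum (n + 1) e < 0 → G e = 0) →
      ∫⁻ e, G e = c * ∫⁻ t in Ioi (0 : ℝ), ENNReal.ofReal (t ^ n) *
        ∫⁻ θ in {e | coordSum (n + 1) e = 1}, G (t • θ) ∂μH[(n : ℝ)] := by
  set V := LinearMap.ker (coordSum (n + 1))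
  set Ψ := (kerCoordSumProd n).toContinuousLinearEquiv with hΨ
  set m : Measure (V × ℝ) := (μH[(n : ℝ)] : Measure V).prod volume with hm
  have hΨm : (Measure.map Ψ m).IsAddHaarMeasure := ContinuousLinearEquiv.isAddHaarMeasure_map Ψ m
  -- Uniqueness of Haar measure supplies `c`. Its value, which involves the tilt of the basis vector
  -- against the hyperplane, is never needed.
  obtain ⟨c, hc0, hctop, hc⟩ : ∃ c : ℝ≥0∞, c ≠ 0 ∧ c ≠ ∞ ∧
      (volume : Measure (EuclideanSpace ℝ (Fin (n + 1)))) = c • Measure.map Ψ m :=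
    ⟨_, ENNReal.coe_ne_zero.2 (Measure.addHaarScalarFactor_pos_of_isAddHaarMeasure _ _).ne',
      ENNReal.coe_ne_top, Measure.isAddLeftInvariant_eq_smul volume (Measure.map Ψ m)⟩
  refine ⟨c, hc0, hctop, fun G hG hneg => ?_⟩
  rw [hc, lintegral_smul_measure, smul_eq_mul, lintegral_map hG Ψ.continuous.measurable]
  congr 1
  have hGΨ : Measurable (fun z : V × ℝ => G (Ψ z)) := hG.comp Ψ.continuous.measurable
  rw [hm, lintegral_prod_symm _ hGΨ.aemeasurable]
  have happ : ∀ (v : V) (t : ℝ), Ψ (v, t) = (v : EuclideanSpace ℝ (Fin (n + 1))) + t • EuclideanSpace.single 0 1 := fun v t => rfl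
  rw [← lintegral_indicator measurableSet_Ioi]
  refine lintegral_congr_ae ?_
  filter_upwards [Measure.ae_ne volume (0 : ℝ)] with t ht
  rcases lt_or_gt_of_ne ht with h | h
  · rw [indicator_of_notMem (by simp [h.le])]
    refine (lintegral_congr fun v => hneg _ ?_).trans lintegral_zero
    rw [happ, map_add, map_smul, coordSum_single, LinearMap.mem_ker.1 v.2]
    simpa using h
  · rw [indicator_of_mem (by exact h), ← map_coe_add_hausdorffMeasure,
      (isometry_coe_add n).isClosedEmbedding.measurableEmbedding.lintegral_map]
    -- On the slice at height `t`, substituting `t • v` for `v` scales the measure by `t ^ n` and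
    -- turns the point into `t • (v + e₀)`, a dilate of a point of the unit hyperplane.
    rw [lintegral_haar_eq_mul_lintegral_smul _ _ h, finrank_ker_coordSum]
    congr 1
    refine lintegral_congr fun v => ?_
    rw [happ, smul_add]
    rfl

/-! ### Sign reflections and polar coordinates for the ℓ₁ norm. -/

section Reflections

variable {d : ℕ}

/-- The reflection changing the sign of the coordinates where `s` is `false`. -/
noncomputable def signFlip (s : Fin d → Bool) :
    EuclideanSpace ℝ (Fin d) ≃ₗᵢ[ℝ] EuclideanSpace ℝ (Fin d) :=
  LinearIsometryEquiv.piLpCongrRight 2 fun i =>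
    if s i then LinearIsometryEquiv.refl ℝ ℝ else LinearIsometryEquiv.neg ℝ

theorem signFlip_apply (s : Fin d → Bool) (e : EuclideanSpace ℝ (Fin d)) (i : Fin d) :
    signFlip s e i = if s i then e i else -e i := by
  simp only [signFlip, LinearIsometryEquiv.piLpCongrRight_apply]
  split_ifs <;> simp

theorem signFlip_signFlip (s : Fin d → Bool) (e : EuclideanSpace ℝ (Fin d)) :
    signFlip s (signFlip s e) = e := by
  ext i
  simp only [signFlip_apply]
  split_ifs <;> simp

/-- The vectors with a given sign pattern, zero counting as positive. -/
def signCell (s : Fin d → Bool) : Set (EuclideanSpace ℝ (Fin d)) :=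
  {e | ∀ i, s i = decide (0 ≤ e i)}

theorem mem_signCell {s : Fin d → Bool} {e : EuclideanSpace ℝ (Fin d)} :
    e ∈ signCell s ↔ ∀ i, s i = decide (0 ≤ e i) := Iff.rfl

theorem measurableSet_signCell (s : Fin d → Bool) : MeasurableSet (signCell s) := by
  have : signCell s = ⋂ i, {e : EuclideanSpace ℝ (Fin d) | s i = decide (0 ≤ e i)} := by
    ext e; simp [signCell]
  rw [this]
  refine MeasurableSet.iInter fun i => ?_
  rcases h : s i with _ | _
  · have : {e : EuclideanSpace ℝ (Fin d) | false = decide (0 ≤ e i)} =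
        {e : EuclideanSpace ℝ (Fin d) | e i < 0} := by ext e; simp
    rw [this]
    exact measurableSet_lt (by fun_prop) (by fun_prop)
  · have : {e : EuclideanSpace ℝ (Fin d) | true = decide (0 ≤ e i)} =
        {e : EuclideanSpace ℝ (Fin d) | 0 ≤ e i} := by ext e; simp
    rw [this]
    exact measurableSet_le (by fun_prop) (by fun_prop)

theorem sum_indicator_signCell (F : EuclideanSpace ℝ (Fin d) → ℝ≥0∞)
    (e : EuclideanSpace ℝ (Fin d)) : ∑ s, (signCell s).indicator F e = F e := by
  rw [Finset.sum_eq_single (fun i => decide (0 ≤ e i))]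
  · exact indicator_of_mem (mem_signCell.2 fun i => rfl) F
  · intro s _ hs
    exact indicator_of_notMem (fun h => hs (funext (mem_signCell.1 h))) F
  · simp

theorem coordSum_signFlip_of_mem_signCell {s : Fin d → Bool} {e : EuclideanSpace ℝ (Fin d)}
    (h : e ∈ signCell s) : coordSum d (signFlip s e) = ∑ i, |e i| := by
  rw [coordSum_apply]
  refine Finset.sum_congr rfl fun i _ => ?_
  rw [signFlip_apply, h i]
  by_cases h0 : 0 ≤ e i
  · simp [h0, abs_of_nonneg h0]
  · simp [h0, abs_of_neg (not_le.1 h0)]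

theorem smul_mem_signCell_iff {s : Fin d → Bool} {e : EuclideanSpace ℝ (Fin d)} {t : ℝ}
    (ht : 0 < t) : t • e ∈ signCell s ↔ e ∈ signCell s := by
  simp [signCell, mul_nonneg_iff_of_pos_left ht]

end Reflections

theorem measurableSet_l1Sphere (d : ℕ) : MeasurableSet (l1Sphere d) :=
  (isClosed_eq (by fun_prop) continuous_const).measurableSet

theorem measurableSet_l1Ball (d : ℕ) : MeasurableSet (l1Ball d) :=
  (isClosed_le (by fun_prop) continuous_const).measurableSet

/-- Integration in `ℓ₁` polar coordinates, up to a constant. -/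
theorem exists_lintegral_eq_lintegral_l1Sphere (n : ℕ) : ∃ c : ℝ≥0∞, c ≠ 0 ∧ c ≠ ∞ ∧
    ∀ F : EuclideanSpace ℝ (Fin (n + 1)) → ℝ≥0∞, Measurable F →
      ∫⁻ e, F e = c * ∫⁻ t in Ioi (0 : ℝ), ENNReal.ofReal (t ^ n) *
        ∫⁻ θ in l1Sphere (n + 1), F (t • θ) ∂μH[(n : ℝ)] := by
  obtain ⟨c, hc0, hctop, hc⟩ := exists_lintegral_eq_lintegral_hyperplane n
  refine ⟨c, hc0, hctop, fun F hF => ?_⟩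
  set H : Set (EuclideanSpace ℝ (Fin (n + 1))) := {e | coordSum (n + 1) e = 1} with hH
  have hHm : MeasurableSet H :=
    (isClosed_eq (LinearMap.continuous_of_finiteDimensional _) continuous_const).measurableSet
  -- `G s` is the part of `F` in the cell `s`, reflected into the nonnegative orthant, where the ℓ₁
  -- sphere is a piece of the hyperplane of coordinate sum 1.
  set G : (Fin (n + 1) → Bool) → EuclideanSpace ℝ (Fin (n + 1)) → ℝ≥0∞ :=
    fun s e => (signCell s).indicator F (signFlip s e) with hG
  have hGm : ∀ s, Measurable (G s) := fun s =>
    (hF.indicator (measurableSet_signCell s)).comp (signFlip s).continuous.measurable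
  have hGneg : ∀ s e, coordSum (n + 1) e < 0 → G s e = 0 := by
    intro s e he
    refine indicator_of_notMem (fun h => ?_) F
    have := coordSum_signFlip_of_mem_signCell h
    rw [signFlip_signFlip] at this
    exact absurd he (not_lt.2 (this ▸ Finset.sum_nonneg fun i _ => abs_nonneg _))
  have hcell : ∀ s, ∫⁻ e, (signCell s).indicator F e = ∫⁻ e, G s e := fun s =>
    ((signFlip s).measurePreserving.lintegral_comp
      (hF.indicator (measurableSet_signCell s))).symm
  -- Reflections are isometries, so they preserve Hausdorff measure and carry each face of the
  -- sphere to the positive one. Cells are invariant under positive dilations, so `t` does not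
  -- interfere.
  have hsphere : ∀ s, ∀ t : ℝ, 0 < t → ∫⁻ θ in H, G s (t • θ) ∂μH[(n : ℝ)] =
      ∫⁻ θ in l1Sphere (n + 1), (signCell s).indicator F (t • θ) ∂μH[(n : ℝ)] := by
    intro s t ht
    have e1 := (signFlip s).toIsometryEquiv.measurePreserving_hausdorffMeasure (n : ℝ)
    rw [← lintegral_indicator hHm, ← lintegral_indicator (measurableSet_l1Sphere _)]
    have hm : Measurable ((l1Sphere (n + 1)).indicator
        fun θ => (signCell s).indicator F (t • θ)) :=
      ((hF.indicator (measurableSet_signCell s)).comp (measurable_const_smul t)).indicator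
        (measurableSet_l1Sphere _)
    rw [← e1.lintegral_comp hm]
    refine lintegral_congr fun θ => ?_
    change H.indicator (fun θ => G s (t • θ)) θ = (l1Sphere (n + 1)).indicator
      (fun θ => (signCell s).indicator F (t • θ)) (signFlip s θ)
    by_cases hmem : signFlip s θ ∈ signCell s
    · have h1 := coordSum_signFlip_of_mem_signCell hmem
      rw [signFlip_signFlip] at h1
      have h2 : θ ∈ H ↔ signFlip s θ ∈ l1Sphere (n + 1) := by
        simp only [hH, l1Sphere, mem_ofPred_eq, h1]
      by_cases h3 : θ ∈ H
      · rw [indicator_of_mem h3, indicator_of_mem (h2.1 h3)]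
        simp only [hG, map_smul]
      · rw [indicator_of_notMem h3, indicator_of_notMem (fun h => h3 (h2.2 h))]
    · have hz : (signCell s).indicator F (t • signFlip s θ) = 0 :=
        indicator_of_notMem (fun h => hmem ((smul_mem_signCell_iff ht).1 h)) F
      have h4 : G s (t • θ) = 0 := by simpa only [hG, map_smul] using hz
      rw [(indicator_apply_eq_zero (s := H) (f := fun θ => G s (t • θ))).2 fun _ => h4,
        (indicator_apply_eq_zero (f := fun θ => (signCell s).indicator F (t • θ))).2 fun _ => hz]
  have hmeas : ∀ s, Measurable fun t : ℝ => ∫⁻ θ in H, G s (t • θ) ∂μH[(n : ℝ)] := fun s =>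
    Measurable.lintegral_prod_right'
      (f := fun z : ℝ × EuclideanSpace ℝ (Fin (n + 1)) => G s (z.1 • z.2))
      ((hGm s).comp (by fun_prop))
  have hpow : Measurable fun t : ℝ => ENNReal.ofReal (t ^ n) := by fun_prop
  calc ∫⁻ e, F e = ∫⁻ e, ∑ s, (signCell s).indicator F e := by simp_rw [sum_indicator_signCell]
    _ = ∑ s, ∫⁻ e, G s e := by
      rw [lintegral_finsetSum _ fun s _ => hF.indicator (measurableSet_signCell s)]
      simp_rw [hcell]
    _ = c * ∫⁻ t in Ioi (0 : ℝ), ∑ s, ENNReal.ofReal (t ^ n) *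
        ∫⁻ θ in H, G s (t • θ) ∂μH[(n : ℝ)] := by
      rw [lintegral_finsetSum _ fun s _ => by exact hpow.mul (hmeas s), Finset.mul_sum]
      exact Finset.sum_congr rfl fun s _ => hc _ (hGm s) (hGneg s)
    _ = _ := by
      congr 1
      refine setLIntegral_congr_fun measurableSet_Ioi fun t ht => ?_
      simp only
      rw [← Finset.mul_sum]
      congr 1
      have hm : ∀ s, Measurable fun θ => (signCell s).indicator F (t • θ) := fun s =>
        (hF.indicator (measurableSet_signCell s)).comp (measurable_const_smul t)
      rw [Finset.sum_congr rfl fun s _ => hsphere s t ht, ← lintegral_finsetSum _ fun s _ => hm s]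
      simp_rw [sum_indicator_signCell]

theorem norm_le_sum_abs {d : ℕ} (e : EuclideanSpace ℝ (Fin d)) : ‖e‖ ≤ ∑ i, |e i| := by
  rw [EuclideanSpace.norm_eq, Real.sqrt_le_left (Finset.sum_nonneg fun i _ => abs_nonneg _)]
  simpa using Finset.sum_sq_le_sq_sum_of_nonneg (s := Finset.univ) (f := fun i => |e i|)
    fun i _ => abs_nonneg _

theorem sum_abs_smul {d : ℕ} (t : ℝ) (e : EuclideanSpace ℝ (Fin d)) :
    ∑ i, |(t • e) i| = |t| * ∑ i, |e i| := by
  simp [abs_mul, Finset.mul_sum]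

theorem volume_l1Ball_lt_top (d : ℕ) : volume (l1Ball d) < ∞ := by
  refine (measure_mono (fun e he => ?_)).trans_lt (measure_closedBall_lt_top (x := 0) (r := 1))
  rw [mem_closedBall_zero_iff]
  exact (norm_le_sum_abs e).trans he

theorem volume_l1Ball_pos (d : ℕ) : 0 < volume (l1Ball d) := by
  have ho : IsOpen {e : EuclideanSpace ℝ (Fin d) | ∑ i, |e i| < 1} :=
    isOpen_lt (by fun_prop) continuous_const
  refine (ho.measure_pos volume ⟨0, by simp⟩).trans_le (measure_mono fun e he => ?_)
  exact le_of_lt (show ∑ i, |e i| < 1 from he)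

theorem lintegral_Ioc_zero_one_pow (n : ℕ) :
    ∫⁻ t in Ioc (0 : ℝ) 1, ENNReal.ofReal (t ^ n) = ENNReal.ofReal (1 / (n + 1)) := by
  rw [← ofReal_integral_eq_lintegral_ofReal]
  · rw [← intervalIntegral.integral_of_le zero_le_one, integral_pow]
    simp
  · exact (continuous_pow n).integrableOn_Ioc
  · filter_upwards [ae_restrict_mem measurableSet_Ioc] with t ht
    exact pow_nonneg ht.1.le n

/-- Testing the polar formula on the ball determines its constant. The measure is left general so as
to cover both raw and normalized surface measure. -/
theorem lintegral_indicator_l1Ball_smul (n : ℕ) (μ : Measure (EuclideanSpace ℝ (Fin (n + 1))))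
    (hμ : ∀ᵐ θ ∂μ, θ ∈ l1Sphere (n + 1)) :
    ∫⁻ t in Ioi (0 : ℝ), ENNReal.ofReal (t ^ n) *
      ∫⁻ θ, (l1Ball (n + 1)).indicator 1 (t • θ) ∂μ =
      ENNReal.ofReal (1 / (n + 1)) * μ univ := by
  have h : ∀ t ∈ Ioi (0 : ℝ), ENNReal.ofReal (t ^ n) *
      ∫⁻ θ, (l1Ball (n + 1)).indicator 1 (t • θ) ∂μ =
      (Ioc (0 : ℝ) 1).indicator (fun t => ENNReal.ofReal (t ^ n) * μ univ) t := by
    intro t ht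
    have hmem : ∀ θ ∈ l1Sphere (n + 1), t • θ ∈ l1Ball (n + 1) ↔ t ≤ 1 := by
      intro θ hθ
      have h1 : ∑ i, |θ i| = 1 := hθ
      change ∑ i, |(t • θ) i| ≤ 1 ↔ _
      rw [sum_abs_smul, h1, mul_one, abs_of_pos (by exact ht)]
    by_cases h1 : t ≤ 1
    · rw [indicator_of_mem (show t ∈ Ioc (0 : ℝ) 1 from ⟨ht, h1⟩)]
      congr 1
      rw [← lintegral_one]
      refine lintegral_congr_ae ?_
      filter_upwards [hμ] with θ hθ
      rw [indicator_of_mem ((hmem θ hθ).2 h1)]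
      rfl
    · rw [indicator_of_notMem (fun h => h1 h.2)]
      refine mul_eq_zero_of_right _ ?_
      rw [← lintegral_zero (μ := μ)]
      refine lintegral_congr_ae ?_
      filter_upwards [hμ] with θ hθ
      rw [indicator_of_notMem (fun h => h1 ((hmem θ hθ).1 h))]
  rw [setLIntegral_congr_fun measurableSet_Ioi h, setLIntegral_indicator measurableSet_Ioc,
    inter_eq_left.2 Ioc_subset_Ioi_self, lintegral_mul_const _ (by fun_prop),
    lintegral_Ioc_zero_one_pow]

/-- Polar integration of the ball's indicator expresses its positive finite volume as a positive
finite multiple of the measure of the sphere, so normalization is legitimate. -/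
theorem hausdorffMeasure_l1Sphere_ne (n : ℕ) :
    μH[(n : ℝ)] (l1Sphere (n + 1)) ≠ 0 ∧ μH[(n : ℝ)] (l1Sphere (n + 1)) ≠ ∞ := by
  obtain ⟨c, hc0, hctop, hc⟩ := exists_lintegral_eq_lintegral_l1Sphere n
  have h := hc ((l1Ball (n + 1)).indicator 1) (measurable_one.indicator (measurableSet_l1Ball _))
  rw [lintegral_indicator_l1Ball_smul _ _ (ae_restrict_mem (measurableSet_l1Sphere _)),
    lintegral_indicator_one (measurableSet_l1Ball _), Measure.restrict_apply_univ] at h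
  have h1 := volume_l1Ball_pos (n + 1)
  have h2 := volume_l1Ball_lt_top (n + 1)
  have h3 : ENNReal.ofReal (1 / ((n : ℝ) + 1)) ≠ 0 := by
    rw [Ne, ENNReal.ofReal_eq_zero, not_le]; positivity
  constructor <;> intro h0 <;> rw [h0] at h
  · simp [h1.ne'] at h
  · rw [ENNReal.mul_top h3, ENNReal.mul_top hc0] at h
    exact h2.ne h

theorem uniformL1Sphere_succ (n : ℕ) : uniformL1Sphere (n + 1) =
    (μH[(n : ℝ)] (l1Sphere (n + 1)))⁻¹ • μH[(n : ℝ)].restrict (l1Sphere (n + 1)) := by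
  have : ((n + 1 : ℕ) : ℝ) - 1 = n := by push_cast; ring
  rw [uniformL1Sphere, this, ProbabilityTheory.cond]

instance isProbabilityMeasure_uniformL1Sphere (n : ℕ) :
    IsProbabilityMeasure (uniformL1Sphere (n + 1)) := by
  rw [uniformL1Sphere_succ]
  have h := hausdorffMeasure_l1Sphere_ne n
  constructor
  rw [Measure.smul_apply, Measure.restrict_apply_univ, smul_eq_mul, ENNReal.inv_mul_cancel h.1 h.2]

theorem ae_mem_l1Sphere (n : ℕ) : ∀ᵐ θ ∂uniformL1Sphere (n + 1), θ ∈ l1Sphere (n + 1) := by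
  rw [uniformL1Sphere_succ]
  exact Measure.ae_smul_measure (ae_restrict_mem (measurableSet_l1Sphere _)) _

/-- Integration in `ℓ₁` polar coordinates. -/
theorem lintegral_eq_lintegral_uniformL1Sphere (n : ℕ)
    {F : EuclideanSpace ℝ (Fin (n + 1)) → ℝ≥0∞} (hF : Measurable F) :
    ∫⁻ e, F e = ENNReal.ofReal ((n + 1) * volume.real (l1Ball (n + 1))) *
      ∫⁻ t in Ioi (0 : ℝ), ENNReal.ofReal (t ^ n) *
        ∫⁻ θ, F (t • θ) ∂uniformL1Sphere (n + 1) := by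
  obtain ⟨c, hc0, hctop, hc⟩ := exists_lintegral_eq_lintegral_l1Sphere n
  have hS := hausdorffMeasure_l1Sphere_ne n
  have key : ∀ F : EuclideanSpace ℝ (Fin (n + 1)) → ℝ≥0∞, Measurable F →
      ∫⁻ e, F e = c * μH[(n : ℝ)] (l1Sphere (n + 1)) *
      ∫⁻ t in Ioi (0 : ℝ), ENNReal.ofReal (t ^ n) *
        ∫⁻ θ, F (t • θ) ∂uniformL1Sphere (n + 1) := by
    intro F hF
    rw [hc F hF, mul_assoc, ← lintegral_const_mul' _ _ hS.2]
    congr 1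
    refine lintegral_congr fun t => ?_
    rw [uniformL1Sphere_succ, lintegral_smul_measure, smul_eq_mul, mul_left_comm,
      ← mul_assoc (μH[(n : ℝ)] (l1Sphere (n + 1))), ENNReal.mul_inv_cancel hS.1 hS.2, one_mul]
  rw [key F hF]
  congr 1
  have h := key ((l1Ball (n + 1)).indicator 1) (measurable_one.indicator (measurableSet_l1Ball _))
  rw [lintegral_indicator_l1Ball_smul _ _ (ae_mem_l1Sphere n), measure_univ, mul_one,
    lintegral_indicator_one (measurableSet_l1Ball _)] at h
  rw [ENNReal.ofReal_mul (by positivity), Measure.real, ENNReal.ofReal_toReal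
    (volume_l1Ball_lt_top _).ne, h, mul_left_comm, ← ENNReal.ofReal_mul (by positivity),
    mul_one_div_cancel (by positivity), ENNReal.ofReal_one, mul_one]

/-- The radial measure `t ^ n dt` on `(0, ∞)`. -/
noncomputable def radialMeasure (n : ℕ) : Measure ℝ :=
  (volume.restrict (Ioi 0)).withDensity fun t => ENNReal.ofReal (t ^ n)

instance (n : ℕ) : SFinite (radialMeasure n) := by unfold radialMeasure; infer_instance

theorem integral_radialMeasure (n : ℕ) (a : ℝ → ℝ) :
    ∫ t, a t ∂radialMeasure n = ∫ t in Ioi 0, t ^ n * a t := by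
  rw [radialMeasure, integral_withDensity_eq_integral_toReal_smul (by fun_prop) (by simp)]
  refine setIntegral_congr_fun measurableSet_Ioi fun t ht => ?_
  have : 0 ≤ t ^ n := pow_nonneg (le_of_lt ht) n
  simp [ENNReal.toReal_ofReal this]

theorem ae_radialMeasure_pos (n : ℕ) : ∀ᵐ t ∂radialMeasure n, 0 < t :=
  (withDensity_absolutelyContinuous _ _).ae_le (ae_restrict_mem measurableSet_Ioi)

/-- As an identity of measures, the polar formula transfers Bochner integrals without an
integrability hypothesis. -/
theorem volume_eq_smul_map_radialMeasure (n : ℕ) :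
    (volume : Measure (EuclideanSpace ℝ (Fin (n + 1)))) =
      ENNReal.ofReal ((n + 1) * volume.real (l1Ball (n + 1))) •
      Measure.map (fun z : ℝ × EuclideanSpace ℝ (Fin (n + 1)) => z.1 • z.2)
        ((radialMeasure n).prod (uniformL1Sphere (n + 1))) := by
  ext s hs
  have hm : Measurable (s.indicator (1 : EuclideanSpace ℝ (Fin (n + 1)) → ℝ≥0∞)) :=
    measurable_one.indicator hs
  have hsm : Measurable (fun z : ℝ × EuclideanSpace ℝ (Fin (n + 1)) => z.1 • z.2) := by fun_prop
  rw [← lintegral_indicator_one hs, lintegral_eq_lintegral_uniformL1Sphere n hm,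
    Measure.smul_apply, ← lintegral_indicator_one hs, lintegral_map hm hsm,
    lintegral_prod _ (by exact (hm.comp hsm).aemeasurable), smul_eq_mul, radialMeasure,
    lintegral_withDensity_eq_lintegral_mul _ (by fun_prop)
      (by exact Measurable.lintegral_prod_right' (hm.comp hsm))]
  rfl

theorem integral_eq_integral_radialMeasure_prod (n : ℕ) {g : EuclideanSpace ℝ (Fin (n + 1)) → ℝ}
    (hg : Measurable g) :
    ∫ e, g e = ((n + 1) * volume.real (l1Ball (n + 1))) *
      ∫ z, g (z.1 • z.2) ∂(radialMeasure n).prod (uniformL1Sphere (n + 1)) := by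
  have hsm : Measurable (fun z : ℝ × EuclideanSpace ℝ (Fin (n + 1)) => z.1 • z.2) := by fun_prop
  conv_lhs => rw [volume_eq_smul_map_radialMeasure n]
  rw [integral_smul_measure, integral_map hsm.aemeasurable hg.aestronglyMeasurable,
    ENNReal.toReal_ofReal (by positivity), smul_eq_mul]

theorem ae_radialMeasure_prod (n : ℕ) :
    ∀ᵐ z ∂(radialMeasure n).prod (uniformL1Sphere (n + 1)), 0 < z.1 ∧ z.2 ∈ l1Sphere (n + 1) := by
  have h1 := (Measure.quasiMeasurePreserving_fst (μ := radialMeasure n)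
    (ν := uniformL1Sphere (n + 1))).ae (ae_radialMeasure_pos n)
  have h2 := (Measure.quasiMeasurePreserving_snd (μ := radialMeasure n)
    (ν := uniformL1Sphere (n + 1))).ae (ae_mem_l1Sphere n)
  filter_upwards [h1, h2] with z hz1 hz2 using ⟨hz1, hz2⟩

theorem integral_eq_of_polar_mul (n : ℕ) {g b : EuclideanSpace ℝ (Fin (n + 1)) → ℝ}
    {a : ℝ → ℝ} (hg : Measurable g)
    (h : ∀ t > 0, ∀ θ ∈ l1Sphere (n + 1), g (t • θ) = a t * b θ) :
    ∫ e, g e = ((n + 1) * volume.real (l1Ball (n + 1))) *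
      ((∫ t in Ioi 0, t ^ n * a t) * ∫ θ, b θ ∂uniformL1Sphere (n + 1)) := by
  rw [integral_eq_integral_radialMeasure_prod n hg, ← integral_radialMeasure, ← integral_prod_mul]
  congr 1
  refine integral_congr_ae ?_
  filter_upwards [ae_radialMeasure_prod n] with z hz using h _ hz.1 _ hz.2

theorem measurePreserving_neg_uniformL1Sphere (n : ℕ) :
    MeasurePreserving (fun e => -e) (uniformL1Sphere (n + 1)) (uniformL1Sphere (n + 1)) := by
  have h := (IsometryEquiv.neg (EuclideanSpace ℝ (Fin (n + 1)))).measurePreserving_hausdorffMeasure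
    (n : ℝ)
  have h2 := h.restrict_preimage (measurableSet_l1Sphere (n + 1))
  have h3 : (IsometryEquiv.neg (EuclideanSpace ℝ (Fin (n + 1)))) ⁻¹' l1Sphere (n + 1) =
      l1Sphere (n + 1) := by
    ext e; simp [l1Sphere]
  rw [h3] at h2
  rw [uniformL1Sphere_succ]
  exact h2.smul_measure _

/-! ### The one-homogeneous extension and its gradient. -/

section Homogeneous

variable {d : ℕ}

theorem sum_abs_le_sqrt_mul_norm (e : EuclideanSpace ℝ (Fin d)) :
    ∑ i, |e i| ≤ √d * ‖e‖ := by
  rw [EuclideanSpace.norm_eq, ← Real.sqrt_mul (by positivity)]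
  refine Real.le_sqrt_of_sq_le ?_
  simpa using sq_sum_le_card_mul_sum_sq (s := Finset.univ) (f := fun i => |e i|)

theorem abs_sum_abs_sub_le (e e' : EuclideanSpace ℝ (Fin d)) :
    |(∑ i, |e' i|) - (∑ i, |e i|)| ≤ √d * ‖e' - e‖ := by
  refine le_trans ?_ (sum_abs_le_sqrt_mul_norm (e' - e))
  rw [← Finset.sum_sub_distrib]
  refine (Finset.abs_sum_le_sum_abs _ _).trans (Finset.sum_le_sum fun i _ => ?_)
  simpa using abs_abs_sub_abs_le_abs_sub (e' i) (e i)

theorem sum_abs_nonneg (e : EuclideanSpace ℝ (Fin d)) : 0 ≤ ∑ i, |e i| :=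
  Finset.sum_nonneg fun _ _ => abs_nonneg _

theorem eq_zero_of_sum_abs_eq_zero {e : EuclideanSpace ℝ (Fin d)} (h : ∑ i, |e i| = 0) : e = 0 :=
  norm_le_zero_iff.1 ((norm_le_sum_abs e).trans h.le)

/-- The extension of a function on the `ℓ₁` sphere that is homogeneous of degree one. -/
noncomputable def l1Homogenize (g : EuclideanSpace ℝ (Fin d) → ℝ)
    (w : EuclideanSpace ℝ (Fin d)) : ℝ :=
  (∑ i, |w i|) * g ((∑ i, |w i|)⁻¹ • w)

variable {L : ℝ≥0} {g : EuclideanSpace ℝ (Fin d) → ℝ}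

theorem abs_l1Homogenize_le (hg : LipschitzWith L g) (h0 : g 0 = 0)
    (w : EuclideanSpace ℝ (Fin d)) : |l1Homogenize g w| ≤ L * ‖w‖ := by
  have h := hg.dist_le_mul ((∑ i, |w i|)⁻¹ • w) 0
  rw [Real.dist_eq, h0, sub_zero, dist_zero_right, norm_smul, norm_inv,
    Real.norm_of_nonneg (sum_abs_nonneg w)] at h
  rw [l1Homogenize, abs_mul, abs_of_nonneg (sum_abs_nonneg w)]
  rcases (sum_abs_nonneg w).eq_or_lt with hw | hw
  · rw [← hw, zero_mul]; positivity
  · calc _ ≤ (∑ i, |w i|) * (L * ((∑ i, |w i|)⁻¹ * ‖w‖)) := by gcongr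
      _ = L * ‖w‖ := by field_simp

/-- Split the increment into the change of `g` along the normalized vectors and the change of the ℓ₁
norm, which is `√d`-Lipschitz. The constant depends on the base point `w` on purpose: `‖w‖₂ / ‖w‖₁`
has mean square of order `1 / d`, so `√d` is compensated on average, whereas a uniform constant
would lose a factor `d`. -/
theorem abs_l1Homogenize_sub_le (hg : LipschitzWith L g) (h0 : g 0 = 0)
    (w w' : EuclideanSpace ℝ (Fin d)) :
    |l1Homogenize g w' - l1Homogenize g w| ≤
      L * (1 + 2 * √d * (‖w‖ / ∑ i, |w i|)) * ‖w' - w‖ := by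
  rcases (sum_abs_nonneg w).eq_or_lt with hw | hw
  · have hw0 := eq_zero_of_sum_abs_eq_zero hw.symm
    subst hw0
    have : l1Homogenize g 0 = 0 := by simp [l1Homogenize]
    simpa [this] using abs_l1Homogenize_le hg h0 w'
  rcases (sum_abs_nonneg w').eq_or_lt with hw' | hw'
  · have hw0 := eq_zero_of_sum_abs_eq_zero hw'.symm
    subst hw0
    have : l1Homogenize g 0 = 0 := by simp [l1Homogenize]
    rw [this, zero_sub, abs_neg, zero_sub, norm_neg]
    refine (abs_l1Homogenize_le hg h0 w).trans ?_
    have : (1 : ℝ) ≤ 1 + 2 * √d * (‖w‖ / ∑ i, |w i|) := by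
      have : 0 ≤ 2 * √(d : ℝ) * (‖w‖ / ∑ i, |w i|) := by positivity
      linarith
    gcongr
    exact le_mul_of_one_le_right L.2 this
  have hN := abs_sum_abs_sub_le w w'
  simp only [l1Homogenize]
  set N := ∑ i, |w i|
  set N' := ∑ i, |w' i|
  have e1 : N' * g (N'⁻¹ • w') - N * g (N⁻¹ • w) =
      N' * (g (N'⁻¹ • w') - g (N⁻¹ • w)) + (N' - N) * g (N⁻¹ • w) := by ring
  have h1 : |g (N'⁻¹ • w') - g (N⁻¹ • w)| ≤ L * ‖N'⁻¹ • w' - N⁻¹ • w‖ := by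
    simpa [Real.dist_eq, dist_eq_norm] using hg.dist_le_mul (N'⁻¹ • w') (N⁻¹ • w)
  have h2 : |g (N⁻¹ • w)| ≤ L * (‖w‖ / N) := by
    have := hg.dist_le_mul (N⁻¹ • w) 0
    rw [Real.dist_eq, h0, sub_zero, dist_zero_right, norm_smul, norm_inv,
      Real.norm_of_nonneg hw.le] at this
    rwa [div_eq_inv_mul]
  have h3 : N' * ‖N'⁻¹ • w' - N⁻¹ • w‖ ≤ ‖w' - w‖ + |N' - N| * (‖w‖ / N) := by
    have e2 : N' • (N'⁻¹ • w' - N⁻¹ • w) = (w' - w) - ((N' - N) * N⁻¹) • w := by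
      rw [smul_sub, smul_smul, smul_smul, mul_inv_cancel₀ hw'.ne', one_smul, sub_mul,
        mul_inv_cancel₀ hw.ne', sub_smul, one_smul]
      abel
    calc N' * ‖N'⁻¹ • w' - N⁻¹ • w‖ = ‖N' • (N'⁻¹ • w' - N⁻¹ • w)‖ := by
          rw [norm_smul, Real.norm_of_nonneg hw'.le]
      _ ≤ ‖w' - w‖ + ‖((N' - N) * N⁻¹) • w‖ := by rw [e2]; exact norm_sub_le _ _
      _ = _ := by
          rw [norm_smul, norm_mul, norm_inv, Real.norm_of_nonneg hw.le, Real.norm_eq_abs]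
          ring
  rw [e1]
  have hr : 0 ≤ ‖w‖ / N := by positivity
  calc _ ≤ N' * |g (N'⁻¹ • w') - g (N⁻¹ • w)| + |N' - N| * |g (N⁻¹ • w)| := by
        refine (abs_add_le _ _).trans ?_
        rw [abs_mul, abs_mul, abs_of_pos hw']
    _ ≤ N' * (L * ‖N'⁻¹ • w' - N⁻¹ • w‖) + |N' - N| * (L * (‖w‖ / N)) := by gcongr
    _ = L * (N' * ‖N'⁻¹ • w' - N⁻¹ • w‖) + L * (|N' - N| * (‖w‖ / N)) := by ring
    _ ≤ L * (‖w' - w‖ + |N' - N| * (‖w‖ / N)) + L * (|N' - N| * (‖w‖ / N)) := by gcongr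
    _ = L * ‖w' - w‖ + 2 * L * (|N' - N| * (‖w‖ / N)) := by ring
    _ ≤ L * ‖w' - w‖ + 2 * L * (√d * ‖w' - w‖ * (‖w‖ / N)) := by gcongr
    _ = _ := by ring

theorem norm_div_sum_abs_le_one (w : EuclideanSpace ℝ (Fin d)) : ‖w‖ / ∑ i, |w i| ≤ 1 :=
  div_le_one_of_le₀ (norm_le_sum_abs w) (sum_abs_nonneg w)

/-- Needed only qualitatively, for Rademacher's theorem, integrability and the Poincaré inequality.
-/
theorem lipschitzWith_l1Homogenize (hg : LipschitzWith L g) (h0 : g 0 = 0) :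
    LipschitzWith (L * (1 + 2 * NNReal.sqrt d)) (l1Homogenize g) := by
  refine LipschitzWith.of_dist_le_mul fun w' w => ?_
  rw [Real.dist_eq, dist_eq_norm]
  refine (abs_l1Homogenize_sub_le hg h0 w w').trans ?_
  push_cast
  have h1 := norm_div_sum_abs_le_one w
  have : 2 * √(d : ℝ) * (‖w‖ / ∑ i, |w i|) ≤ 2 * √d := mul_le_of_le_one_right (by positivity) h1
  gcongr

theorem l1Homogenize_neg (hodd : ∀ e, g (-e) = -g e) (w : EuclideanSpace ℝ (Fin d)) :
    l1Homogenize g (-w) = -l1Homogenize g w := by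
  simp [l1Homogenize, hodd]

theorem l1Homogenize_smul {t : ℝ} (ht : 0 < t) {θ : EuclideanSpace ℝ (Fin d)}
    (hθ : θ ∈ l1Sphere d) : l1Homogenize g (t • θ) = t * g θ := by
  have h : ∑ i, |θ i| = 1 := hθ
  rw [l1Homogenize, sum_abs_smul, h, mul_one, abs_of_pos ht, smul_smul, inv_mul_cancel₀ ht.ne',
    one_smul]

end Homogeneous

/-- The sum is the squared Euclidean norm of the gradient `a`. The pointwise Lipschitz bound
controls the operator norm of the derivative, and evaluating the derivative at `a` itself gives
`‖a‖² ≤ C ‖a‖`. The detour through `Φ` replaces the sup norm of `Fin n → ℝ` by the Euclidean one. -/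
theorem sum_lineDeriv_sq_le {n : ℕ} {G : EuclideanSpace ℝ (Fin n) → ℝ} {w : Fin n → ℝ} {C : ℝ}
    (hC : 0 ≤ C) (hd : DifferentiableAt ℝ (fun w : Fin n → ℝ => G (WithLp.toLp 2 w)) w)
    (h : ∀ e, |G e - G (WithLp.toLp 2 w)| ≤ C * ‖e - WithLp.toLp 2 w‖) :
    ∑ i, lineDeriv ℝ (fun w : Fin n → ℝ => G (WithLp.toLp 2 w)) w (Pi.single i 1) ^ 2 ≤ C ^ 2 := by
  set F := fun w : Fin n → ℝ => G (WithLp.toLp 2 w)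
  set D := fderiv ℝ F w
  set Φ := (EuclideanSpace.equiv (Fin n) ℝ).toContinuousLinearMap
  have hG : HasFDerivAt G (D ∘L Φ) (WithLp.toLp 2 w) := by
    have h1 : HasFDerivAt F D (Φ (WithLp.toLp 2 w)) := hd.hasFDerivAt
    exact h1.comp (WithLp.toLp 2 w) Φ.hasFDerivAt
  have hn : ‖D ∘L Φ‖ ≤ C := hG.le_of_lip' hC (Eventually.of_forall h)
  simp_rw [hd.lineDeriv_eq_fderiv]
  set a : Fin n → ℝ := fun i => D (Pi.single i 1) with ha
  have hDa : (D ∘L Φ) (WithLp.toLp 2 a) = ∑ i, a i ^ 2 := by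
    change D a = _
    conv_lhs => rw [pi_eq_sum_univ' a]
    rw [map_sum]
    refine Finset.sum_congr rfl fun i _ => ?_
    rw [map_smul, smul_eq_mul, sq]
  have hnorm : ‖WithLp.toLp 2 a‖ ^ 2 = ∑ i, a i ^ 2 := by
    rw [EuclideanSpace.norm_sq_eq]; simp
  have h1 : ∑ i, a i ^ 2 ≤ C * ‖WithLp.toLp 2 a‖ := by
    rw [← hDa]
    exact (le_abs_self _).trans (((D ∘L Φ).le_opNorm _).trans (by gcongr))
  change ∑ i, a i ^ 2 ≤ C ^ 2
  rw [← hnorm] at h1 ⊢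
  have h2 := norm_nonneg (WithLp.toLp 2 a)
  nlinarith [sq_nonneg (C - ‖WithLp.toLp 2 a‖)]

/-! ### Laplace moments and the second moment of odd functions on the sphere. -/

theorem integral_pow_mul_exp_neg (n k : ℕ) :
    ∫ t in Ioi (0 : ℝ), t ^ n * (Real.exp (-t) * t ^ k) = (n + k).factorial := by
  rw [← Real.Gamma_nat_eq_factorial, Real.Gamma_eq_integral (by positivity)]
  refine setIntegral_congr_fun measurableSet_Ioi fun t _ => ?_
  simp only [add_sub_cancel_right, Real.rpow_natCast]
  ring

theorem integral_sq_laplaceMeasure : ∫ x, x ^ 2 ∂laplaceMeasure = 2 := by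
  have h := (integral_laplaceMeasure_eq (g := fun x => x ^ 2)
    (by simpa using integrableOn_sq_mul_exp_neg_Ioi)
    (by simpa using integrableOn_sq_mul_exp_neg_Ioi)).2
  have h2 := integral_pow_mul_exp_neg 0 2
  simp only [pow_zero, one_mul, mul_comm (Real.exp _)] at h2
  simp only [neg_sq, h2] at h
  rw [h]
  norm_num [Nat.factorial]

theorem integral_laplacePi_toLp (n : ℕ) (φ : EuclideanSpace ℝ (Fin n) → ℝ) :
    ∫ w, φ (WithLp.toLp 2 w) ∂laplacePi n = ∫ e, Real.exp (-∑ i, |e i|) / 2 ^ n * φ e := by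
  rw [laplacePi_eq_withDensity, integral_withDensity_eq_integral_toReal_smul (by fun_prop) (by simp),
    ← (PiLp.volume_preserving_toLp (Fin n)).integral_comp
      (MeasurableEquiv.toLp 2 (Fin n → ℝ)).measurableEmbedding]
  refine integral_congr_ae (ae_of_all _ fun w => ?_)
  simp [ENNReal.toReal_ofReal (show 0 ≤ Real.exp (-∑ i, |w i|) / 2 ^ n by positivity)]

theorem integral_laplacePi_toLp_eq_zero {n : ℕ} {φ : EuclideanSpace ℝ (Fin n) → ℝ}
    (h : ∀ e, φ (-e) = -φ e) : ∫ w, φ (WithLp.toLp 2 w) ∂laplacePi n = 0 := by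
  rw [integral_laplacePi_toLp]
  have h1 := integral_neg_eq_self
    (fun e : EuclideanSpace ℝ (Fin n) => Real.exp (-∑ i, |e i|) / 2 ^ n * φ e) volume
  simp only [PiLp.neg_apply, abs_neg, h, mul_neg, integral_neg] at h1
  linarith

/-- Under the Laplace product the ℓ₁ radius has density proportional to `t ^ n e^{-t}` and is
independent of the uniform direction; the factor is the `k`-th moment of the radius. -/
theorem integral_laplacePi_polar (n k : ℕ) {φ b : EuclideanSpace ℝ (Fin (n + 1)) → ℝ}
    (hφ : Measurable φ) (h : ∀ t > 0, ∀ θ ∈ l1Sphere (n + 1), φ (t • θ) = t ^ k * b θ) :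
    ∫ w, φ (WithLp.toLp 2 w) ∂laplacePi (n + 1) =
      ((n + k).factorial / n.factorial) * ∫ θ, b θ ∂uniformL1Sphere (n + 1) := by
  have key : ∀ (k : ℕ) (φ b : EuclideanSpace ℝ (Fin (n + 1)) → ℝ), Measurable φ →
      (∀ t > 0, ∀ θ ∈ l1Sphere (n + 1), φ (t • θ) = t ^ k * b θ) →
      ∫ w, φ (WithLp.toLp 2 w) ∂laplacePi (n + 1) =
      ((n + 1) * volume.real (l1Ball (n + 1)) / 2 ^ (n + 1)) * (n + k).factorial *
        ∫ θ, b θ ∂uniformL1Sphere (n + 1) := by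
    intro k φ b hφ h
    rw [integral_laplacePi_toLp, integral_eq_of_polar_mul n
      (a := fun t => Real.exp (-t) * t ^ k / 2 ^ (n + 1)) (b := b) (by fun_prop)]
    · simp_rw [← mul_div_assoc]
      rw [integral_div, integral_pow_mul_exp_neg]
      ring
    · intro t ht θ hθ
      have h1 : ∑ i, |θ i| = 1 := hθ
      rw [h t ht θ hθ, sum_abs_smul, h1, abs_of_pos ht]
      ring_nf
  -- The constant function 1 eliminates the volume of the ball from the constant.
  have h0 := key 0 (fun _ => 1) (fun _ => 1) measurable_const (by simp)
  simp only [integral_const, probReal_univ, smul_eq_mul, mul_one, add_zero] at h0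
  rw [key k φ b hφ h, eq_div_of_mul_eq (by positivity) h0.symm]
  ring

/-- The squared Euclidean norm is 2-homogeneous and has Laplace mean `2 (n + 1)`; divide by the
second radial moment `(n + 2) (n + 1)`. -/
theorem integral_norm_sq_uniformL1Sphere (n : ℕ) :
    ∫ θ, ‖θ‖ ^ 2 ∂uniformL1Sphere (n + 1) = 2 / (n + 2) := by
  have h := integral_laplacePi_polar n 2 (φ := fun e => ‖e‖ ^ 2) (b := fun e => ‖e‖ ^ 2)
    (by fun_prop) (fun t ht θ _ => by rw [norm_smul, mul_pow, Real.norm_of_nonneg ht.le])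
  have h2 : ∫ w : Fin (n + 1) → ℝ, ‖WithLp.toLp 2 w‖ ^ 2 ∂laplacePi (n + 1) = 2 * (n + 1) := by
    simp_rw [EuclideanSpace.norm_sq_eq, Real.norm_eq_abs, sq_abs]
    have hi : ∀ i : Fin (n + 1), Integrable (fun w : Fin (n + 1) → ℝ => w i ^ 2)
        (laplacePi (n + 1)) := fun i =>
      integrable_comp_eval (μ := fun _ => laplaceMeasure) (i := i) integrable_sq_laplaceMeasure
    rw [integral_finsetSum _ fun i _ => hi i]
    have : ∀ i : Fin (n + 1), ∫ w : Fin (n + 1) → ℝ, w i ^ 2 ∂laplacePi (n + 1) = 2 := fun i => by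
      rw [← integral_sq_laplaceMeasure]
      exact integral_comp_eval (μ := fun _ => laplaceMeasure) (i := i)
        (f := fun x : ℝ => x ^ 2) (by fun_prop)
    simp [this]
    ring
  rw [h2, Nat.factorial_succ, Nat.factorial_succ] at h
  have h3 : (n.factorial : ℝ) ≠ 0 := by positivity
  push_cast at h
  field_simp at h ⊢
  nlinarith

/-- A Poincaré-type inequality for odd Lipschitz functions on the `ℓ₁` sphere. -/
theorem LipschitzWith.integral_sq_uniformL1Sphere_le (n : ℕ) {L : ℝ≥0}
    {g : EuclideanSpace ℝ (Fin (n + 1)) → ℝ} (hg : LipschitzWith L g)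
    (hodd : ∀ e, g (-e) = -g e) :
    ∫ θ, g θ ^ 2 ∂uniformL1Sphere (n + 1) ≤ 72 * (L : ℝ) ^ 2 / ((n : ℝ) + 1) ^ 2 := by
  have h0 : g 0 = 0 := by
    have := hodd 0
    rw [neg_zero] at this
    linarith
  set H := l1Homogenize g
  have hHl := lipschitzWith_l1Homogenize hg h0
  have hFl := hHl.comp (PiLp.lipschitzWith_toLp 2 (fun _ : Fin (n + 1) => ℝ))
  set F : (Fin (n + 1) → ℝ) → ℝ := fun w => H (WithLp.toLp 2 w) with hF
  have hP := LipschitzWith.poincare_laplacePi (F := F) hFl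
  have hmean : ∫ w, F w ∂laplacePi (n + 1) = 0 :=
    integral_laplacePi_toLp_eq_zero (l1Homogenize_neg hodd)
  have hsq : ∫ w, F w ^ 2 ∂laplacePi (n + 1) =
      (n + 2) * (n + 1) * ∫ θ, g θ ^ 2 ∂uniformL1Sphere (n + 1) := by
    have := integral_laplacePi_polar n 2 (φ := fun e => H e ^ 2) (b := fun e => g e ^ 2)
      (hHl.continuous.measurable.pow_const 2)
      (fun t ht θ hθ => by
        simp only [H, l1Homogenize_smul ht hθ, mul_pow])
    rw [hF, this, Nat.factorial_succ, Nat.factorial_succ]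
    have h3 : (n.factorial : ℝ) ≠ 0 := by positivity
    push_cast
    field_simp
    ring
  set ψ : EuclideanSpace ℝ (Fin (n + 1)) → ℝ := fun e => (‖e‖ / ∑ i, |e i|) ^ 2 with hψ
  have hψm : Measurable ψ := by fun_prop
  have hψi : Integrable (fun w => ψ (WithLp.toLp 2 w)) (laplacePi (n + 1)) := by
    refine Integrable.of_bound (hψm.comp (by fun_prop)).aestronglyMeasurable 1
      (ae_of_all _ fun w => ?_)
    rw [Real.norm_of_nonneg (sq_nonneg _)]
    exact pow_le_one₀ (div_nonneg (norm_nonneg _) (sum_abs_nonneg _)) (norm_div_sum_abs_le_one _)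
  have hψint : ∫ w, ψ (WithLp.toLp 2 w) ∂laplacePi (n + 1) = 2 / (n + 2) := by
    -- `ψ` is invariant under positive dilations, hence the exponent 0.
    rw [integral_laplacePi_polar n 0 (φ := ψ) (b := fun e => ‖e‖ ^ 2) hψm,
      integral_norm_sq_uniformL1Sphere]
    · have h3 : (n.factorial : ℝ) ≠ 0 := by positivity
      simp [h3]
    · intro t ht θ hθ
      have h1 : ∑ i, |θ i| = 1 := hθ
      simp only [hψ]
      rw [norm_smul, sum_abs_smul, h1, Real.norm_eq_abs, abs_of_pos ht]
      field_simp
  have hgrad : ∑ i, ∫ w, lineDeriv ℝ F w (Pi.single i 1) ^ 2 ∂laplacePi (n + 1) ≤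
      (L : ℝ) ^ 2 * (2 + 8 * (n + 1) * (2 / (n + 2))) := by
    rw [← integral_finsetSum _ fun i _ => LipschitzWith.integrable_lineDeriv_sq (F := F) hFl _]
    have hi : Integrable (fun w => (L : ℝ) ^ 2 * (2 + 8 * (n + 1) * ψ (WithLp.toLp 2 w)))
        (laplacePi (n + 1)) := ((integrable_const _).add (hψi.const_mul _)).const_mul _
    have hint : ∫ w, (L : ℝ) ^ 2 * (2 + 8 * (n + 1) * ψ (WithLp.toLp 2 w)) ∂laplacePi (n + 1) =
        (L : ℝ) ^ 2 * (2 + 8 * (n + 1) * (2 / (n + 2))) := by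
      rw [integral_const_mul, integral_add (integrable_const _) (hψi.const_mul _),
        integral_const_mul, hψint]
      simp
    rw [← hint]
    refine integral_mono_ae (integrable_finsetSum _ fun i _ =>
      LipschitzWith.integrable_lineDeriv_sq (F := F) hFl _) hi ?_
    have hac : laplacePi (n + 1) ≪ volume := by
      rw [laplacePi_eq_withDensity]; exact withDensity_absolutelyContinuous _ _
    filter_upwards [hac.ae_le (LipschitzWith.ae_differentiableAt (f := F) hFl)] with w hw
    have hr : 0 ≤ ‖WithLp.toLp 2 w‖ / ∑ i, |w i| :=
      div_nonneg (norm_nonneg _) (sum_abs_nonneg (WithLp.toLp 2 w))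
    refine (sum_lineDeriv_sq_le (C := L * (1 + 2 * √(n + 1 : ℕ) *
      (‖WithLp.toLp 2 w‖ / ∑ i, |w i|))) (by positivity) hw
      fun e => abs_l1Homogenize_sub_le hg h0 (WithLp.toLp 2 w) e).trans ?_
    rw [mul_pow]
    refine mul_le_mul_of_nonneg_left ?_ (by positivity)
    simp only [hψ]
    set r := ‖WithLp.toLp 2 w‖ / ∑ i, |w i|
    have hs : √((n + 1 : ℕ) : ℝ) ^ 2 = n + 1 := by rw [Real.sq_sqrt (by positivity)]; simp
    -- This is `(1 + s)² ≤ 2 + 2 s²` with `s = 2 √d r`.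
    nlinarith [sq_nonneg (1 - 2 * √((n + 1 : ℕ) : ℝ) * r)]
  rw [hsq, hmean] at hP
  have h18 : 2 + 8 * ((n : ℝ) + 1) * (2 / (n + 2)) ≤ 18 := by
    have : 8 * ((n : ℝ) + 1) * (2 / (n + 2)) ≤ 16 := by
      rw [mul_div_assoc', div_le_iff₀ (by positivity)]
      linarith
    linarith
  have hfin : ((n : ℝ) + 2) * (n + 1) * ∫ θ, g θ ^ 2 ∂uniformL1Sphere (n + 1) ≤
      72 * (L : ℝ) ^ 2 := by
    have h5 : (L : ℝ) ^ 2 * (2 + 8 * (n + 1) * (2 / (n + 2))) ≤ (L : ℝ) ^ 2 * 18 := by gcongr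
    linarith
  rw [le_div_iff₀ (by positivity)]
  have h6 : 0 ≤ ∫ θ, g θ ^ 2 ∂uniformL1Sphere (n + 1) := integral_nonneg fun θ => sq_nonneg _
  have h7 : 0 ≤ ((n : ℝ) + 1) * ∫ θ, g θ ^ 2 ∂uniformL1Sphere (n + 1) := by positivity
  nlinarith

/-! ### The divergence theorem on the ℓ₁ ball. -/

theorem measurable_real_sign : Measurable Real.sign := by
  unfold Real.sign
  exact Measurable.ite measurableSet_Iio measurable_const
    (Measurable.ite measurableSet_Ioi measurable_const measurable_const)

theorem abs_real_sign_le_one (x : ℝ) : |Real.sign x| ≤ 1 := by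
  rcases Real.sign_apply_eq x with h | h | h <;> simp [h]

theorem real_sign_mul_of_pos {t : ℝ} (ht : 0 < t) (x : ℝ) : Real.sign (t * x) = Real.sign x := by
  rcases lt_trichotomy x 0 with h | h | h
  · rw [Real.sign_of_neg h, Real.sign_of_neg (mul_neg_of_pos_of_neg ht h)]
  · simp [h]
  · rw [Real.sign_of_pos h, Real.sign_of_pos (mul_pos ht h)]

theorem ae_euclidean_apply_ne_zero {d : ℕ} (i : Fin d) :
    ∀ᵐ w : EuclideanSpace ℝ (Fin d), w i ≠ 0 := by
  have h := (PiLp.volume_preserving_ofLp (Fin d)).quasiMeasurePreserving.ae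
    (Measure.ae_eval_ne (μ := fun _ : Fin d => (volume : Measure ℝ)) i 0)
  exact h

theorem ae_sum_abs_ne (n : ℕ) (r : ℝ) :
    ∀ᵐ w : EuclideanSpace ℝ (Fin (n + 1)), ∑ i, |w i| ≠ r := by
  have hm : MeasurableSet {w : EuclideanSpace ℝ (Fin (n + 1)) | ∑ i, |w i| = r} :=
    (isClosed_eq (by fun_prop) continuous_const).measurableSet
  have h := lintegral_eq_lintegral_uniformL1Sphere n (measurable_one.indicator hm)
  rw [lintegral_indicator_one hm] at h
  suffices hz : volume {w : EuclideanSpace ℝ (Fin (n + 1)) | ∑ i, |w i| = r} = 0 by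
    rw [ae_iff]; simpa using hz
  rw [h]
  refine mul_eq_zero_of_right _ ?_
  rw [← lintegral_zero (μ := volume.restrict (Ioi (0 : ℝ)))]
  refine lintegral_congr_ae ?_
  filter_upwards [ae_restrict_of_ae (Measure.ae_ne volume r), ae_restrict_mem measurableSet_Ioi]
    with t ht ht0
  refine mul_eq_zero_of_right _ ?_
  rw [← lintegral_zero (μ := uniformL1Sphere (n + 1))]
  refine lintegral_congr_ae ?_
  filter_upwards [ae_mem_l1Sphere n] with θ hθ
  refine indicator_of_notMem (fun hmem => ht ?_) _
  have h1 : ∑ i, |θ i| = 1 := hθ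
  have h2 : ∑ i, |(t • θ) i| = r := hmem
  rwa [sum_abs_smul, h1, mul_one, abs_of_pos (by exact ht0)] at h2

section Cutoff

/-- The piecewise affine function equal to `1` on `(-∞, 1]` and to `0` on `[1 + ε, ∞)`. -/
noncomputable def cutoff (ε r : ℝ) : ℝ := max 0 (min 1 ((1 + ε - r) / ε))

variable {ε : ℝ}

theorem cutoff_nonneg (r : ℝ) : 0 ≤ cutoff ε r := le_max_left _ _

theorem cutoff_le_one (r : ℝ) : cutoff ε r ≤ 1 := max_le zero_le_one (min_le_left _ _)

theorem cutoff_of_le_one (hε : 0 < ε) {r : ℝ} (hr : r ≤ 1) : cutoff ε r = 1 := by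
  have : 1 ≤ (1 + ε - r) / ε := by rw [le_div_iff₀ hε]; linarith
  rw [cutoff, min_eq_left this, max_eq_right zero_le_one]

theorem cutoff_of_ge (hε : 0 < ε) {r : ℝ} (hr : 1 + ε ≤ r) : cutoff ε r = 0 := by
  have : (1 + ε - r) / ε ≤ 0 := div_nonpos_of_nonpos_of_nonneg (by linarith) hε.le
  rw [cutoff, max_eq_left ((min_le_right _ _).trans this)]

theorem cutoff_of_mem_Ioo (hε : 0 < ε) {r : ℝ} (hr : r ∈ Ioo 1 (1 + ε)) :
    cutoff ε r = (1 + ε - r) / ε := by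
  have h1 : (1 + ε - r) / ε ≤ 1 := by rw [div_le_iff₀ hε]; linarith [hr.1]
  have h2 : 0 ≤ (1 + ε - r) / ε := div_nonneg (by linarith [hr.2]) hε.le
  rw [cutoff, min_eq_right h1, max_eq_right h2]

theorem lipschitzWith_cutoff (hε : 0 < ε) : LipschitzWith (Real.toNNReal ε⁻¹) (cutoff ε) := by
  have h : LipschitzWith (Real.toNNReal ε⁻¹) fun r : ℝ => (1 + ε - r) / ε := by
    refine LipschitzWith.of_dist_le_mul fun r s => ?_
    rw [Real.dist_eq, Real.dist_eq, Real.coe_toNNReal _ (by positivity)]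
    have : (1 + ε - r) / ε - (1 + ε - s) / ε = -(ε⁻¹ * (r - s)) := by field_simp; ring
    rw [this, abs_neg, abs_mul, abs_of_pos (inv_pos.2 hε)]
  exact (h.const_min 1).const_max 0

theorem hasDerivAt_cutoff (hε : 0 < ε) {r : ℝ} (h1 : r ≠ 1) (h2 : r ≠ 1 + ε) :
    HasDerivAt (cutoff ε) ((Ioo 1 (1 + ε)).indicator (fun _ => -ε⁻¹) r) r := by
  rcases lt_or_gt_of_ne h1 with h | h
  · rw [indicator_of_notMem fun hm => absurd hm.1 h.not_gt]
    refine (hasDerivAt_const r (1 : ℝ)).congr_of_eventuallyEq ?_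
    filter_upwards [Iio_mem_nhds h] with s hs using cutoff_of_le_one hε (le_of_lt hs)
  rcases lt_or_gt_of_ne h2 with h' | h'
  · rw [indicator_of_mem (show r ∈ Ioo 1 (1 + ε) from ⟨h, h'⟩)]
    have hd : HasDerivAt (fun s : ℝ => (1 + ε - s) / ε) (-ε⁻¹) r := by
      have := ((hasDerivAt_id r).const_sub (1 + ε)).div_const ε
      simpa [neg_div] using this
    refine hd.congr_of_eventuallyEq ?_
    filter_upwards [Ioo_mem_nhds h h'] with s hs using cutoff_of_mem_Ioo hε hs
  · rw [indicator_of_notMem fun hm => absurd hm.2 h'.not_gt]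
    refine (hasDerivAt_const r (0 : ℝ)).congr_of_eventuallyEq ?_
    filter_upwards [Ioi_mem_nhds h'] with s hs using cutoff_of_ge hε (le_of_lt hs)

end Cutoff

theorem hasLineDerivAt_sum_abs {d : ℕ} {w : EuclideanSpace ℝ (Fin d)} {i : Fin d} (hi : w i ≠ 0) :
    HasLineDerivAt ℝ (fun w : EuclideanSpace ℝ (Fin d) => ∑ j, |w j|) (Real.sign (w i)) w
      (EuclideanSpace.single i 1) := by
  have hs : HasDerivAt (fun t : ℝ => |w i + t|) (Real.sign (w i)) 0 := by
    have h := hasDerivAt_abs (x := w i + 0) (by simpa using hi)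
    have h1 := h.comp (0 : ℝ) ((hasDerivAt_id (0 : ℝ)).const_add (w i))
    have hsign : (SignType.sign (w i + 0) : ℝ) * 1 = Real.sign (w i) := by
      rw [add_zero, mul_one]
      rcases lt_or_gt_of_ne hi with h | h
      · simp [h, Real.sign_of_neg h]
      · simp [h, Real.sign_of_pos h]
    rw [hsign] at h1
    exact h1
  have h2 : ∀ t : ℝ, ∑ j, |(w + t • EuclideanSpace.single i (1 : ℝ)) j| =
      |w i + t| + ∑ j ∈ Finset.univ.erase i, |w j| := by
    intro t
    rw [← Finset.add_sum_erase _ _ (Finset.mem_univ i)]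
    congr 1
    · simp
    · refine Finset.sum_congr rfl fun j hj => ?_
      simp [Finset.ne_of_mem_erase hj]
  rw [HasLineDerivAt]
  simp_rw [h2]
  exact hs.add_const _

theorem lipschitzWith_sum_abs (d : ℕ) :
    LipschitzWith (NNReal.sqrt d) fun w : EuclideanSpace ℝ (Fin d) => ∑ j, |w j| :=
  LipschitzWith.of_dist_le_mul fun w' w => by
    rw [Real.dist_eq, dist_eq_norm]
    simpa using abs_sum_abs_sub_le w w'

/-- The chain rule works off the coordinate hyperplane and the two spheres bounding the shell, all
null sets. The direction is negated because integration by parts moves the derivative onto the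
cutoff in that form. -/
theorem ae_lineDeriv_cutoff (n : ℕ) (i : Fin (n + 1)) {ε : ℝ} (hε : 0 < ε) :
    ∀ᵐ w : EuclideanSpace ℝ (Fin (n + 1)),
      lineDeriv ℝ (fun w => cutoff ε (∑ j, |w j|)) w (-EuclideanSpace.single i 1) =
      (Ioo 1 (1 + ε)).indicator (fun _ => ε⁻¹) (∑ j, |w j|) * Real.sign (w i) := by
  filter_upwards [ae_euclidean_apply_ne_zero i, ae_sum_abs_ne n 1, ae_sum_abs_ne n (1 + ε)]
    with w h0 h1 h2
  have hN := hasLineDerivAt_sum_abs h0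
  have hc : HasDerivAt (cutoff ε) ((Ioo 1 (1 + ε)).indicator (fun _ => -ε⁻¹) (∑ j, |w j|))
      (∑ j, |(w + (0 : ℝ) • EuclideanSpace.single i (1 : ℝ)) j|) := by
    simpa using hasDerivAt_cutoff hε h1 h2
  have hd : HasLineDerivAt ℝ (fun w => cutoff ε (∑ j, |w j|))
      ((Ioo 1 (1 + ε)).indicator (fun _ => -ε⁻¹) (∑ j, |w j|) * Real.sign (w i)) w
      (EuclideanSpace.single i 1) := HasDerivAt.comp (h₂ := cutoff ε)
      (h := fun t : ℝ => ∑ j, |(w + t • EuclideanSpace.single i (1 : ℝ)) j|) (0 : ℝ) hc hN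
  rw [lineDeriv_neg, hd.lineDeriv, ← neg_mul]
  congr 1
  by_cases hm : (∑ j, |w j|) ∈ Ioo 1 (1 + ε) <;> simp [hm]

theorem continuous_integral_sign_mul_smul {n : ℕ} (i : Fin (n + 1)) {K : ℝ≥0}
    {G : EuclideanSpace ℝ (Fin (n + 1)) → ℝ} (hG : LipschitzWith K G) :
    Continuous fun t : ℝ => ∫ θ, Real.sign (θ i) * G (t • θ) ∂uniformL1Sphere (n + 1) := by
  rw [continuous_iff_continuousAt]
  intro t₀
  refine continuousAt_of_dominated (bound := fun _ => |G 0| + K * (|t₀| + 1)) ?_ ?_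
    (integrable_const _) ?_
  · refine Eventually.of_forall fun t => Measurable.aestronglyMeasurable ?_
    exact (measurable_real_sign.comp (by fun_prop)).mul
      (hG.continuous.measurable.comp (by fun_prop))
  · have : ∀ᶠ t in 𝓝 t₀, |t| < |t₀| + 1 :=
      continuous_abs.continuousAt.eventually_lt continuousAt_const (by simp)
    filter_upwards [this] with t ht
    filter_upwards [ae_mem_l1Sphere n] with θ hθ
    have h1 : ‖θ‖ ≤ 1 := (norm_le_sum_abs θ).trans (le_of_eq hθ)
    have h2 := hG.dist_le_mul (t • θ) 0
    rw [Real.dist_eq, dist_zero_right, norm_smul, Real.norm_eq_abs] at h2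
    have h3 : |G (t • θ)| ≤ |G 0| + K * (|t₀| + 1) := by
      have h4 : |t| * ‖θ‖ ≤ |t₀| + 1 := by
        calc |t| * ‖θ‖ ≤ |t| * 1 := by gcongr
          _ ≤ _ := by linarith
      have h5 : (K : ℝ) * (|t| * ‖θ‖) ≤ K * (|t₀| + 1) := by gcongr
      have h6 := abs_sub_abs_le_abs_sub (G (t • θ)) (G 0)
      linarith
    rw [norm_mul, Real.norm_eq_abs, Real.norm_eq_abs]
    calc _ ≤ 1 * |G (t • θ)| := by gcongr; exact abs_real_sign_le_one _
      _ ≤ _ := by rw [one_mul]; exact h3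
  · refine ae_of_all _ fun θ => ContinuousAt.mul continuousAt_const ?_
    exact (hG.continuous.comp (continuous_id.smul continuous_const)).continuousAt

theorem integrable_indicator_radialMeasure (n : ℕ) {a b : ℝ} :
    Integrable ((Ioo a b).indicator fun _ => (1 : ℝ)) (radialMeasure n) := by
  rw [integrable_indicator_iff measurableSet_Ioo, integrableOn_const_iff]
  right
  rw [radialMeasure, withDensity_apply _ measurableSet_Ioo, Measure.restrict_restrict
    measurableSet_Ioo]
  have h : IntegrableOn (fun t : ℝ => t ^ n) (Ioo a b ∩ Ioi 0) :=
    ((continuous_pow n).integrableOn_Icc.mono_set (Ioo_subset_Icc_self)).mono_set inter_subset_left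
  exact h.lintegral_lt_top

/-- In polar coordinates the shell condition involves only the radius and the sign only the
direction, leaving a radial average over `[1, 1 + ε]` of spherical integrals. -/
theorem integral_shell_eq {n : ℕ} (i : Fin (n + 1)) {K : ℝ≥0}
    {G : EuclideanSpace ℝ (Fin (n + 1)) → ℝ} (hG : LipschitzWith K G) {ε : ℝ} (hε : 0 < ε) :
    ∫ w : EuclideanSpace ℝ (Fin (n + 1)),
      (Ioo 1 (1 + ε)).indicator (fun _ => ε⁻¹) (∑ j, |w j|) * Real.sign (w i) * G w =
    ((n + 1) * volume.real (l1Ball (n + 1))) * (ε⁻¹ * ∫ t in (1 : ℝ)..1 + ε,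
      t ^ n * ∫ θ, Real.sign (θ i) * G (t • θ) ∂uniformL1Sphere (n + 1)) := by
  have hmeas : Measurable fun w : EuclideanSpace ℝ (Fin (n + 1)) =>
      (Ioo 1 (1 + ε)).indicator (fun _ => ε⁻¹) (∑ j, |w j|) * Real.sign (w i) * G w :=
    (((measurable_const.indicator measurableSet_Ioo).comp
      (lipschitzWith_sum_abs (n + 1)).continuous.measurable).mul
      (measurable_real_sign.comp (by fun_prop))).mul hG.continuous.measurable
  set h : ℝ × EuclideanSpace ℝ (Fin (n + 1)) → ℝ := fun z =>
    (Ioo 1 (1 + ε)).indicator (fun _ => (1 : ℝ)) z.1 * (Real.sign (z.2 i) * G (z.1 • z.2)) with hh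
  have hhm : Measurable h := ((measurable_const.indicator measurableSet_Ioo).comp
    measurable_fst).mul ((measurable_real_sign.comp (by fun_prop)).mul
      (hG.continuous.measurable.comp (by fun_prop)))
  have hhi : Integrable h ((radialMeasure n).prod (uniformL1Sphere (n + 1))) := by
    refine ((integrable_indicator_radialMeasure n (a := 1) (b := 1 + ε)).mul_prod
      (integrable_const (|G 0| + K * (1 + ε)))).mono' hhm.aestronglyMeasurable ?_
    filter_upwards [ae_radialMeasure_prod n] with z hz
    by_cases hm : z.1 ∈ Ioo 1 (1 + ε)
    · simp only [hh, indicator_of_mem hm, one_mul]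
      have h1 : ‖z.2‖ ≤ 1 := (norm_le_sum_abs z.2).trans (le_of_eq hz.2)
      have h2 := hG.dist_le_mul (z.1 • z.2) 0
      rw [Real.dist_eq, dist_zero_right, norm_smul, Real.norm_of_nonneg hz.1.le] at h2
      have h4 : z.1 * ‖z.2‖ ≤ 1 + ε := by
        calc z.1 * ‖z.2‖ ≤ z.1 * 1 := by have := hz.1; gcongr
          _ ≤ _ := by linarith [hm.2]
      have h5 : (K : ℝ) * (z.1 * ‖z.2‖) ≤ K * (1 + ε) := by gcongr
      have h6 := abs_sub_abs_le_abs_sub (G (z.1 • z.2)) (G 0)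
      rw [norm_mul, Real.norm_eq_abs, Real.norm_eq_abs]
      calc _ ≤ 1 * |G (z.1 • z.2)| := by gcongr; exact abs_real_sign_le_one _
        _ ≤ _ := by rw [one_mul]; linarith
    · simp [hh, indicator_of_notMem hm]
  rw [integral_eq_integral_radialMeasure_prod n hmeas]
  congr 1
  have e1 : ∫ z, (Ioo 1 (1 + ε)).indicator (fun _ => ε⁻¹) (∑ j, |(z.1 • z.2) j|) *
      Real.sign ((z.1 • z.2) i) * G (z.1 • z.2) ∂(radialMeasure n).prod (uniformL1Sphere (n + 1)) =
      ∫ z, ε⁻¹ * h z ∂(radialMeasure n).prod (uniformL1Sphere (n + 1)) := by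
    refine integral_congr_ae ?_
    filter_upwards [ae_radialMeasure_prod n] with z hz
    have h1 : ∑ j, |z.2 j| = 1 := hz.2
    rw [sum_abs_smul, h1, mul_one, abs_of_pos hz.1, PiLp.smul_apply, smul_eq_mul,
      real_sign_mul_of_pos hz.1]
    by_cases hm : z.1 ∈ Ioo 1 (1 + ε)
    · simp only [hh, indicator_of_mem hm]; ring
    · simp only [hh, indicator_of_notMem hm]; ring
  rw [e1, integral_const_mul, integral_prod _ hhi]
  congr 1
  simp only [hh, integral_const_mul]
  rw [integral_radialMeasure, intervalIntegral.integral_of_le (by linarith)]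
  have e2 : ∀ t : ℝ, t ^ n * ((Ioo 1 (1 + ε)).indicator (fun _ => (1 : ℝ)) t *
      ∫ θ, Real.sign (θ i) * G (t • θ) ∂uniformL1Sphere (n + 1)) =
      (Ioo 1 (1 + ε)).indicator (fun t => t ^ n *
        ∫ θ, Real.sign (θ i) * G (t • θ) ∂uniformL1Sphere (n + 1)) t := by
    intro t
    by_cases hm : t ∈ Ioo 1 (1 + ε)
    · simp only [indicator_of_mem hm]; ring
    · simp only [indicator_of_notMem hm]; ring
  simp_rw [e2]
  rw [setIntegral_indicator measurableSet_Ioo, integral_Ioc_eq_integral_Ioo]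
  congr 2
  exact inter_eq_right.2 fun t ht => lt_trans zero_lt_one ht.1

/-- The divergence theorem for Lipschitz functions on the `ℓ₁` ball. -/
theorem LipschitzWith.setIntegral_l1Ball_lineDeriv {n : ℕ} (i : Fin (n + 1)) {K : ℝ≥0}
    {G : EuclideanSpace ℝ (Fin (n + 1)) → ℝ} (hG : LipschitzWith K G) :
    ∫ w in l1Ball (n + 1), lineDeriv ℝ G w (EuclideanSpace.single i 1) =
      ((n + 1) * volume.real (l1Ball (n + 1))) *
        ∫ θ, Real.sign (θ i) * G θ ∂uniformL1Sphere (n + 1) := by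
  set J : ℝ → ℝ := fun t => t ^ n * ∫ θ, Real.sign (θ i) * G (t • θ) ∂uniformL1Sphere (n + 1)
    with hJ
  have hJc : Continuous J := (continuous_pow n).mul (continuous_integral_sign_mul_smul i hG)
  -- Keeping `ε k ≤ 1` makes every cutoff vanish outside the Euclidean ball of radius 2, giving
  -- compact support and a common dominating function.
  set ε : ℕ → ℝ := fun k => 1 / ((k : ℝ) + 1) with hεdef
  have hε : ∀ k, 0 < ε k := fun k => by positivity
  have hε1 : ∀ k, ε k ≤ 1 := fun k => by
    rw [hεdef]; exact div_le_one_of_le₀ (by linarith [(k.cast_nonneg : (0 : ℝ) ≤ k)]) (by positivity)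
  have hεt : Tendsto ε atTop (𝓝 0) := tendsto_one_div_add_atTop_nhds_zero_nat
  have hlip : ∀ k, ∃ D, LipschitzWith D fun w : EuclideanSpace ℝ (Fin (n + 1)) =>
      cutoff (ε k) (∑ j, |w j|) := fun k =>
    ⟨_, (lipschitzWith_cutoff (hε k)).comp (lipschitzWith_sum_abs (n + 1))⟩
  have hball : ∀ w : EuclideanSpace ℝ (Fin (n + 1)), w ∉ Metric.closedBall 0 2 →
      ∀ k, cutoff (ε k) (∑ j, |w j|) = 0 := by
    intro w hw k
    rw [mem_closedBall_zero_iff, not_le] at hw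
    exact cutoff_of_ge (hε k) (by linarith [norm_le_sum_abs w, hε1 k])
  have hibp : ∀ k, ∫ w, lineDeriv ℝ G w (EuclideanSpace.single i 1) *
      cutoff (ε k) (∑ j, |w j|) = ((n + 1) * volume.real (l1Ball (n + 1))) *
        ((ε k)⁻¹ * ∫ t in (1 : ℝ)..1 + ε k, J t) := by
    intro k
    obtain ⟨D, hD⟩ := hlip k
    rw [hG.integral_lineDeriv_mul_eq hD (HasCompactSupport.intro (isCompact_closedBall 0 2)
      fun w hw => hball w hw k), ← integral_shell_eq i hG (hε k)]
    refine integral_congr_ae ?_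
    filter_upwards [ae_lineDeriv_cutoff n i (hε k)] with w hw
    rw [hw]
  have hL : Tendsto (fun k => ∫ w, lineDeriv ℝ G w (EuclideanSpace.single i 1) *
      cutoff (ε k) (∑ j, |w j|)) atTop
      (𝓝 (∫ w in l1Ball (n + 1), lineDeriv ℝ G w (EuclideanSpace.single i 1))) := by
    rw [← integral_indicator (measurableSet_l1Ball _)]
    refine tendsto_integral_of_dominated_convergence
      ((Metric.closedBall (0 : EuclideanSpace ℝ (Fin (n + 1))) 2).indicator fun _ => (K : ℝ))
      (fun k => ?_) ?_ (fun k => ?_) ?_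
    · obtain ⟨D, hD⟩ := hlip k
      exact ((measurable_lineDeriv hG.continuous).mul hD.continuous.measurable).aestronglyMeasurable
    · rw [integrable_indicator_iff measurableSet_closedBall]
      exact integrableOn_const (measure_closedBall_lt_top.ne)
    · refine ae_of_all _ fun w => ?_
      by_cases hw : w ∈ Metric.closedBall (0 : EuclideanSpace ℝ (Fin (n + 1))) 2
      · rw [indicator_of_mem hw, norm_mul, Real.norm_of_nonneg (cutoff_nonneg _)]
        have h1 : ‖lineDeriv ℝ G w (EuclideanSpace.single i 1)‖ ≤ K := by
          simpa using norm_lineDeriv_le_of_lipschitz ℝ hG (x₀ := w)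
            (v := EuclideanSpace.single i (1 : ℝ))
        exact (mul_le_of_le_one_right (norm_nonneg _) (cutoff_le_one _)).trans h1
      · rw [indicator_of_notMem hw, hball w hw k]; simp
    · refine ae_of_all _ fun w => ?_
      by_cases hw : w ∈ l1Ball (n + 1)
      · rw [indicator_of_mem hw]
        refine tendsto_const_nhds.congr fun k => ?_
        rw [cutoff_of_le_one (hε k) hw, mul_one]
      · rw [indicator_of_notMem hw]
        have hw1 : 1 < ∑ j, |w j| := not_le.1 hw
        refine tendsto_const_nhds.congr' ?_
        filter_upwards [hεt.eventually_lt_const (sub_pos.2 hw1)] with k hk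
        rw [cutoff_of_ge (hε k) (by linarith), mul_zero]
  -- Shell averages converge to the value at radius 1 by the fundamental theorem of calculus, `J`
  -- being continuous.
  have hR : Tendsto (fun k => (ε k)⁻¹ * ∫ t in (1 : ℝ)..1 + ε k, J t) atTop (𝓝 (J 1)) := by
    have hd : HasDerivAt (fun u => ∫ t in (1 : ℝ)..u, J t) (J 1) 1 :=
      intervalIntegral.integral_hasDerivAt_right (hJc.intervalIntegrable _ _)
        hJc.stronglyMeasurable.stronglyMeasurableAtFilter hJc.continuousAt
    have hε' : Tendsto ε atTop (𝓝[≠] 0) :=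
      tendsto_nhdsWithin_iff.2 ⟨hεt, Eventually.of_forall fun k => (hε k).ne'⟩
    simpa [Function.comp_def] using hd.tendsto_slope_zero.comp hε'
  have h1 : J 1 = ∫ θ, Real.sign (θ i) * G θ ∂uniformL1Sphere (n + 1) := by simp [hJ]
  rw [← h1]
  refine tendsto_nhds_unique hL ?_
  simp_rw [hibp]
  exact hR.const_mul _

/-! ### The smoothed gradient and the estimator for globally Lipschitz functions. -/

theorem measurable_signVec {d : ℕ} : Measurable (signVec : EuclideanSpace ℝ (Fin d) → _) := by
  unfold signVec
  refine (MeasurableEquiv.toLp 2 (Fin d → ℝ)).measurable.comp (measurable_pi_lambda _ fun i => ?_)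
  exact measurable_real_sign.comp (by fun_prop)

theorem lqNorm_smul {d : ℕ} (q : ℝ≥0∞) [Fact (1 ≤ q)] (c : ℝ) (v : EuclideanSpace ℝ (Fin d)) :
    lqNorm q (c • v) = |c| * lqNorm q v := by
  have : WithLp.toLp q (fun i => (c • v) i) = c • WithLp.toLp q (fun i => v i) := rfl
  rw [lqNorm, this, norm_smul, Real.norm_eq_abs]
  rfl

theorem measurable_lqNorm {d : ℕ} (q : ℝ≥0∞) [Fact (1 ≤ q)] :
    Measurable (lqNorm q : EuclideanSpace ℝ (Fin d) → ℝ) := by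
  unfold lqNorm
  refine Continuous.measurable (continuous_norm.comp ?_)
  exact (PiLp.continuous_toLp q (fun _ : Fin d => ℝ)).comp (by fun_prop)

theorem lqNorm_signVec_sq_le {d : ℕ} {q : ℝ≥0∞} (hq : 1 ≤ q)
    (e : EuclideanSpace ℝ (Fin d)) : lqNorm q (signVec e) ^ 2 ≤ (d : ℝ) ^ (2 / q).toReal := by
  have : Fact (1 ≤ q) := ⟨hq⟩
  have hs : ∀ i, ‖Real.sign (e i)‖ ≤ 1 := fun i => abs_real_sign_le_one _
  rcases eq_or_ne q ∞ with rfl | hqt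
  · have h1 : lqNorm ∞ (signVec e) ≤ 1 := by
      rw [lqNorm, PiLp.norm_eq_ciSup]
      exact Real.iSup_le (fun i => hs i) zero_le_one
    have h0 : 0 ≤ lqNorm ∞ (signVec e) := norm_nonneg _
    simpa using pow_le_one₀ (n := 2) h0 h1
  · have hq0 : 0 < q.toReal := ENNReal.toReal_pos (zero_lt_one.trans_le hq).ne' hqt
    have h1 : lqNorm q (signVec e) ≤ (d : ℝ) ^ (1 / q.toReal) := by
      rw [lqNorm, PiLp.norm_eq_sum hq0]
      gcongr
      calc ∑ i, ‖Real.sign (e i)‖ ^ q.toReal ≤ ∑ _i : Fin d, (1 : ℝ) :=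
            Finset.sum_le_sum fun i _ => Real.rpow_le_one (norm_nonneg _) (hs i) hq0.le
        _ = d := by simp
    have h0 : 0 ≤ lqNorm q (signVec e) := norm_nonneg _
    calc lqNorm q (signVec e) ^ 2 ≤ ((d : ℝ) ^ (1 / q.toReal)) ^ 2 := by gcongr
      _ = (d : ℝ) ^ (2 / q).toReal := by
        rw [← Real.rpow_natCast, ← Real.rpow_mul (by positivity), ENNReal.toReal_div]
        congr 1
        simp
        ring

instance (n : ℕ) : IsProbabilityMeasure (uniformL1Ball (n + 1)) :=
  ProbabilityTheory.cond_isProbabilityMeasure_of_finite (volume_l1Ball_pos _).ne'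
    (volume_l1Ball_lt_top _).ne

theorem uniformL1Ball_absolutelyContinuous (d : ℕ) : uniformL1Ball d ≪ volume :=
  ProbabilityTheory.cond_absolutelyContinuous

theorem ae_mem_l1Ball (d : ℕ) : ∀ᵐ u ∂uniformL1Ball d, u ∈ l1Ball d := by
  rw [uniformL1Ball, ProbabilityTheory.cond]
  exact Measure.ae_smul_measure (ae_restrict_mem (measurableSet_l1Ball _)) _

theorem integral_uniformL1Ball {n : ℕ} (h : EuclideanSpace ℝ (Fin (n + 1)) → ℝ) :
    ∫ u, h u ∂uniformL1Ball (n + 1) =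
      (volume.real (l1Ball (n + 1)))⁻¹ * ∫ u in l1Ball (n + 1), h u := by
  rw [uniformL1Ball, ProbabilityTheory.cond, integral_smul_measure, ENNReal.toReal_inv, smul_eq_mul]
  rfl

section Estimator

variable {n : ℕ} {K : ℝ≥0} {F : EuclideanSpace ℝ (Fin (n + 1)) → ℝ} {γ : ℝ}
  {x : EuclideanSpace ℝ (Fin (n + 1))}

theorem LipschitzWith.comp_add_smul (hF : LipschitzWith K F) (hγ : 0 < γ)
    (x : EuclideanSpace ℝ (Fin (n + 1))) :
    LipschitzWith (K * Real.toNNReal γ) fun u => F (x + γ • u) :=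
  LipschitzWith.of_dist_le_mul fun u v => by
    refine (hF.dist_le_mul _ _).trans (le_of_eq ?_)
    rw [dist_add_left, dist_smul₀, Real.norm_of_nonneg hγ.le]
    push_cast
    rw [Real.coe_toNNReal _ hγ.le]
    ring

theorem ae_differentiableAt_add_smul (hF : LipschitzWith K F) (hγ : 0 < γ)
    (x : EuclideanSpace ℝ (Fin (n + 1))) :
    ∀ᵐ u ∂uniformL1Ball (n + 1), DifferentiableAt ℝ F (x + γ • u) := by
  refine (uniformL1Ball_absolutelyContinuous _).ae_le ?_
  filter_upwards [(hF.comp_add_smul hγ x).ae_differentiableAt (μ := volume)] with u hu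
  -- Rademacher is applied to the rescaled function of `u`; undoing the affine change of variables
  -- returns differentiability of `F` itself.
  have h1 : F = (fun u => F (x + γ • u)) ∘ fun y => γ⁻¹ • (y - x) := by
    ext y
    simp [smul_smul, mul_inv_cancel₀ hγ.ne']
  rw [h1]
  refine DifferentiableAt.comp _ ?_ (by fun_prop)
  simpa [smul_smul, inv_mul_cancel₀ hγ.ne'] using hu

theorem LipschitzWith.hasFDerivAt_l1Smoothing (hF : LipschitzWith K F) (hγ : 0 < γ)
    (x : EuclideanSpace ℝ (Fin (n + 1))) :
    Integrable (fun u => fderiv ℝ F (x + γ • u)) (uniformL1Ball (n + 1)) ∧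
    HasFDerivAt (l1Smoothing F γ) (∫ u, fderiv ℝ F (x + γ • u) ∂uniformL1Ball (n + 1)) x := by
  refine hasFDerivAt_integral_of_dominated_loc_of_lip (F := fun y u => F (y + γ • u))
    (bound := fun _ => (K : ℝ)) (s := univ) univ_mem ?_ ?_ ?_ ?_ (integrable_const _) ?_
  · exact Eventually.of_forall fun y =>
      (hF.continuous.comp (by fun_prop)).aestronglyMeasurable
  · refine Integrable.of_bound (hF.continuous.comp (by fun_prop)).aestronglyMeasurable
      (|F x| + K * γ) ?_
    filter_upwards [ae_mem_l1Ball (n + 1)] with u hu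
    have h1 : ‖u‖ ≤ 1 := (norm_le_sum_abs u).trans hu
    have h2 := hF.dist_le_mul (x + γ • u) x
    rw [Real.dist_eq, dist_self_add_left, norm_smul, Real.norm_of_nonneg hγ.le] at h2
    have h3 : (K : ℝ) * (γ * ‖u‖) ≤ K * (γ * 1) := by gcongr
    have h4 := abs_sub_abs_le_abs_sub (F (x + γ • u)) (F x)
    rw [Real.norm_eq_abs]
    linarith
  · exact ((measurable_fderiv ℝ F).comp (by fun_prop)).aestronglyMeasurable
  · refine ae_of_all _ fun u => LipschitzWith.lipschitzOnWith ?_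
    refine LipschitzWith.of_dist_le_mul fun y z => ?_
    simpa using hF.dist_le_mul (y + γ • u) (z + γ • u)
  · filter_upwards [ae_differentiableAt_add_smul hF hγ x] with u hu
    have h1 : HasFDerivAt (fun y => y + γ • u)
        (ContinuousLinearMap.id ℝ (EuclideanSpace ℝ (Fin (n + 1)))) x :=
      (hasFDerivAt_id x).add_const _
    exact hu.hasFDerivAt.comp x h1

/-- Rescaling gives the factor `γ⁻¹`; in the divergence theorem the volume of the ball cancels
against the normalization, leaving the dimension `n + 1`. -/
theorem LipschitzWith.integral_fderiv_single (hF : LipschitzWith K F) (hγ : 0 < γ)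
    (x : EuclideanSpace ℝ (Fin (n + 1))) (i : Fin (n + 1)) :
    (∫ u, fderiv ℝ F (x + γ • u) ∂uniformL1Ball (n + 1)) (EuclideanSpace.single i 1) =
      γ⁻¹ * ((n + 1) * ∫ θ, Real.sign (θ i) * F (x + γ • θ) ∂uniformL1Sphere (n + 1)) := by
  rw [ContinuousLinearMap.integral_apply (hF.hasFDerivAt_l1Smoothing hγ x).1]
  have h1 : ∀ᵐ u ∂uniformL1Ball (n + 1), fderiv ℝ F (x + γ • u) (EuclideanSpace.single i 1) =
      γ⁻¹ * lineDeriv ℝ (fun u => F (x + γ • u)) u (EuclideanSpace.single i 1) := by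
    filter_upwards [ae_differentiableAt_add_smul hF hγ x] with u hu
    have h2 : HasFDerivAt (fun u => F (x + γ • u)) ((fderiv ℝ F (x + γ • u)) ∘L
        (γ • ContinuousLinearMap.id ℝ (EuclideanSpace ℝ (Fin (n + 1))))) u :=
      HasFDerivAt.comp (g := F) u hu.hasFDerivAt
        (((hasFDerivAt_id u).const_smul γ).const_add x)
    rw [h2.differentiableAt.lineDeriv_eq_fderiv, h2.fderiv]
    simp [inv_mul_cancel_left₀ hγ.ne']
  rw [integral_congr_ae h1, integral_const_mul, integral_uniformL1Ball,
    (hF.comp_add_smul hγ x).setIntegral_l1Ball_lineDeriv i]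
  have h3 : volume.real (l1Ball (n + 1)) ≠ 0 :=
    (ENNReal.toReal_pos (volume_l1Ball_pos _).ne' (volume_l1Ball_lt_top _).ne).ne'
  field_simp

/-- The symmetric difference of `F` at `x` as a function of the displacement. -/
theorem LipschitzWith.symmDiff (hF : LipschitzWith K F) (hγ : 0 < γ)
    (x : EuclideanSpace ℝ (Fin (n + 1))) :
    LipschitzWith (2 * (K * Real.toNNReal γ)) fun e => F (x + γ • e) - F (x - γ • e) := by
  have h1 := hF.comp_add_smul hγ x
  have h2 : LipschitzWith (K * Real.toNNReal γ) fun e => F (x - γ • e) := by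
    refine LipschitzWith.of_dist_le_mul fun u v => ?_
    simpa [sub_eq_add_neg] using h1.dist_le_mul (-u) (-v)
  rw [two_mul]
  exact h1.sub h2

theorem measurable_l1GradEstimator (hF : Continuous F) (γ : ℝ)
    (x : EuclideanSpace ℝ (Fin (n + 1))) : Measurable fun e => l1GradEstimator F γ x e := by
  unfold l1GradEstimator
  have hc : Continuous fun e => ((n + 1 : ℕ) : ℝ) * ((F (x + γ • e) - F (x - γ • e)) / (2 * γ)) :=
    continuous_const.mul (((hF.comp (by fun_prop)).sub (hF.comp (by fun_prop))).div_const _)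
  exact hc.measurable.smul measurable_signVec

theorem LipschitzWith.abs_symmDiff_le (hF : LipschitzWith K F) (hγ : 0 < γ)
    {e : EuclideanSpace ℝ (Fin (n + 1))} (he : e ∈ l1Sphere (n + 1)) :
    |F (x + γ • e) - F (x - γ • e)| ≤ 2 * (K * γ) := by
  have h := (hF.symmDiff hγ x).dist_le_mul e 0
  have h1 : ‖e‖ ≤ 1 := (norm_le_sum_abs e).trans (le_of_eq he)
  simp only [smul_zero, add_zero, sub_zero, sub_self, dist_zero_right, Real.norm_eq_abs] at h
  push_cast at h
  rw [Real.coe_toNNReal _ hγ.le] at h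
  exact h.trans (mul_le_of_le_one_right (by positivity) h1)

theorem lqNorm_l1GradEstimator_sq_le {q : ℝ≥0∞} (hq : 1 ≤ q) (hγ : 0 < γ)
    (F : EuclideanSpace ℝ (Fin (n + 1)) → ℝ) (x e : EuclideanSpace ℝ (Fin (n + 1))) :
    lqNorm q (l1GradEstimator F γ x e) ^ 2 ≤ ((n : ℝ) + 1) ^ 2 / (4 * γ ^ 2) *
      ((n + 1 : ℕ) : ℝ) ^ (2 / q).toReal * (F (x + γ • e) - F (x - γ • e)) ^ 2 := by
  have : Fact (1 ≤ q) := ⟨hq⟩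
  rw [l1GradEstimator, lqNorm_smul, mul_pow, sq_abs]
  have h := lqNorm_signVec_sq_le (d := n + 1) hq e
  calc _ ≤ (((n + 1 : ℕ) : ℝ) * ((F (x + γ • e) - F (x - γ • e)) / (2 * γ))) ^ 2 *
        ((n + 1 : ℕ) : ℝ) ^ (2 / q).toReal := by gcongr
    _ = _ := by push_cast; field_simp; ring

theorem LipschitzWith.integrable_l1GradEstimator (hF : LipschitzWith K F) (hγ : 0 < γ)
    (x : EuclideanSpace ℝ (Fin (n + 1))) :
    Integrable (fun e => l1GradEstimator F γ x e) (uniformL1Sphere (n + 1)) := by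
  refine Integrable.of_bound (measurable_l1GradEstimator hF.continuous γ x).aestronglyMeasurable
    (√(((n : ℝ) + 1) ^ 2 / (4 * γ ^ 2) * ((n + 1 : ℕ) : ℝ) ^ (2 / (2 : ℝ≥0∞)).toReal *
      (2 * (K * γ)) ^ 2)) ?_
  filter_upwards [ae_mem_l1Sphere n] with e he
  refine Real.le_sqrt_of_sq_le ?_
  -- For `q = 2`, `lqNorm` unfolds to the Euclidean norm used by the Bochner integral.
  refine (lqNorm_l1GradEstimator_sq_le (q := 2) one_le_two hγ F x e).trans ?_
  have := hF.abs_symmDiff_le hγ (x := x) he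
  rw [← sq_abs (F (x + γ • e) - F (x - γ • e))]
  gcongr

theorem LipschitzWith.integral_l1GradEstimator_apply (hF : LipschitzWith K F) (hγ : 0 < γ)
    (x : EuclideanSpace ℝ (Fin (n + 1))) (i : Fin (n + 1)) :
    (∫ e, l1GradEstimator F γ x e ∂uniformL1Sphere (n + 1)) i =
      γ⁻¹ * ((n + 1) * ∫ θ, Real.sign (θ i) * F (x + γ • θ) ∂uniformL1Sphere (n + 1)) := by
  have hi := hF.integrable_l1GradEstimator hγ x
  have h1 : (∫ e, l1GradEstimator F γ x e ∂uniformL1Sphere (n + 1)) i =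
      ∫ e, l1GradEstimator F γ x e i ∂uniformL1Sphere (n + 1) :=
    ((EuclideanSpace.proj i : EuclideanSpace ℝ (Fin (n + 1)) →L[ℝ] ℝ).integral_comp_comm hi).symm
  set A : EuclideanSpace ℝ (Fin (n + 1)) → ℝ := fun θ => Real.sign (θ i) * F (x + γ • θ) with hA
  have hAi : Integrable A (uniformL1Sphere (n + 1)) := by
    refine Integrable.of_bound ((measurable_real_sign.comp (by fun_prop)).mul
      (hF.continuous.comp (by fun_prop)).measurable).aestronglyMeasurable (|F x| + K * γ) ?_
    filter_upwards [ae_mem_l1Sphere n] with θ hθ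
    have h1 : ‖θ‖ ≤ 1 := (norm_le_sum_abs θ).trans (le_of_eq hθ)
    have h2 := hF.dist_le_mul (x + γ • θ) x
    rw [Real.dist_eq, dist_self_add_left, norm_smul, Real.norm_of_nonneg hγ.le] at h2
    have h3 : (K : ℝ) * (γ * ‖θ‖) ≤ K * (γ * 1) := by gcongr
    have h4 := abs_sub_abs_le_abs_sub (F (x + γ • θ)) (F x)
    rw [norm_mul, Real.norm_eq_abs, Real.norm_eq_abs]
    calc _ ≤ 1 * |F (x + γ • θ)| := by gcongr; exact abs_real_sign_le_one _
      _ ≤ _ := by linarith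
  have hneg := measurePreserving_neg_uniformL1Sphere n
  have hemb : MeasurableEmbedding (fun e : EuclideanSpace ℝ (Fin (n + 1)) => -e) :=
    (Homeomorph.neg _).measurableEmbedding
  have hAi' : Integrable (fun e => A (-e)) (uniformL1Sphere (n + 1)) :=
    (hneg.integrable_comp_emb hemb).2 hAi
  have hA' : ∫ e, A (-e) ∂uniformL1Sphere (n + 1) = ∫ e, A e ∂uniformL1Sphere (n + 1) :=
    hneg.integral_comp hemb A
  -- The sign is odd, so the symmetric difference is the sum of `A` at `e` and at `-e`; both have
  -- the same integral.
  have h2 : ∀ e, l1GradEstimator F γ x e i = ((n + 1) / (2 * γ)) * (A e + A (-e)) := by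
    intro e
    simp only [l1GradEstimator, signVec, hA, PiLp.smul_apply, PiLp.neg_apply, smul_eq_mul,
      smul_neg, ← sub_eq_add_neg, Real.sign_neg]
    push_cast
    ring
  simp_rw [h1, h2]
  rw [integral_const_mul, integral_add hAi hAi', hA']
  field_simp
  ring

theorem LipschitzWith.hasGradientAt_l1Smoothing (hF : LipschitzWith K F) (hγ : 0 < γ)
    (x : EuclideanSpace ℝ (Fin (n + 1))) :
    HasGradientAt (l1Smoothing F γ) (∫ e, l1GradEstimator F γ x e ∂uniformL1Sphere (n + 1)) x := by
  rw [hasGradientAt_iff_hasFDerivAt]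
  have heq : InnerProductSpace.toDual ℝ (EuclideanSpace ℝ (Fin (n + 1)))
      (∫ e, l1GradEstimator F γ x e ∂uniformL1Sphere (n + 1)) =
      ∫ u, fderiv ℝ F (x + γ • u) ∂uniformL1Ball (n + 1) := by
    apply ContinuousLinearMap.coe_injective
    refine (EuclideanSpace.basisFun (Fin (n + 1)) ℝ).toBasis.ext fun i => ?_
    have h1 := hF.integral_fderiv_single hγ x i
    rw [← hF.integral_l1GradEstimator_apply hγ x i] at h1
    simp only [OrthonormalBasis.coe_toBasis, EuclideanSpace.basisFun_apply,
      ContinuousLinearMap.coe_coe, InnerProductSpace.toDual_apply_apply]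
    rw [h1, EuclideanSpace.inner_single_right]
    simp
  rw [heq]
  exact (hF.hasFDerivAt_l1Smoothing hγ x).2

theorem LipschitzWith.integral_lqNorm_sq_l1GradEstimator_le {q : ℝ≥0∞} (hq : 1 ≤ q)
    (hF : LipschitzWith K F) (hγ : 0 < γ) (x : EuclideanSpace ℝ (Fin (n + 1))) :
    Integrable (fun e => lqNorm q (l1GradEstimator F γ x e) ^ 2) (uniformL1Sphere (n + 1)) ∧
    ∫ e, lqNorm q (l1GradEstimator F γ x e) ^ 2 ∂uniformL1Sphere (n + 1) ≤
      288 * ((n + 1 : ℕ) : ℝ) ^ (2 / q).toReal * (K : ℝ) ^ 2 := by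
  have : Fact (1 ≤ q) := ⟨hq⟩
  set g : EuclideanSpace ℝ (Fin (n + 1)) → ℝ := fun e => F (x + γ • e) - F (x - γ • e) with hg
  have hgl : LipschitzWith (2 * (K * Real.toNNReal γ)) g := hF.symmDiff hγ x
  have hvar := hgl.integral_sq_uniformL1Sphere_le n fun e => by
    simp only [hg, smul_neg, sub_neg_eq_add, ← sub_eq_add_neg]; ring
  have hgi : Integrable (fun e => ((n : ℝ) + 1) ^ 2 / (4 * γ ^ 2) *
      ((n + 1 : ℕ) : ℝ) ^ (2 / q).toReal * g e ^ 2) (uniformL1Sphere (n + 1)) := by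
    refine Integrable.const_mul ?_ _
    refine Integrable.of_bound (hgl.continuous.pow 2).aestronglyMeasurable ((2 * (K * γ)) ^ 2) ?_
    filter_upwards [ae_mem_l1Sphere n] with e he
    rw [norm_pow, Real.norm_eq_abs]
    have := hF.abs_symmDiff_le hγ (x := x) he
    gcongr
  have hle := lqNorm_l1GradEstimator_sq_le hq hγ F x
  have hint : Integrable (fun e => lqNorm q (l1GradEstimator F γ x e) ^ 2)
      (uniformL1Sphere (n + 1)) := by
    refine hgi.mono' (((measurable_lqNorm q).comp
      (measurable_l1GradEstimator hF.continuous γ x)).pow_const 2).aestronglyMeasurable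
      (ae_of_all _ fun e => ?_)
    rw [Real.norm_of_nonneg (sq_nonneg _)]
    exact hle e
  refine ⟨hint, (integral_mono hint hgi hle).trans ?_⟩
  rw [integral_const_mul]
  push_cast at hvar
  rw [Real.coe_toNNReal _ hγ.le] at hvar
  calc _ ≤ ((n : ℝ) + 1) ^ 2 / (4 * γ ^ 2) * ((n + 1 : ℕ) : ℝ) ^ (2 / q).toReal *
        (72 * (2 * (K * γ)) ^ 2 / ((n : ℝ) + 1) ^ 2) := by gcongr
    _ = 72 * ((n + 1 : ℕ) : ℝ) ^ (2 / q).toReal * (K : ℝ) ^ 2 := by field_simp; ring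
    -- The argument gives the constant 72, relaxed here to 288.
    _ ≤ _ := by gcongr; norm_num

end Estimator

/-! ### Localization to functions that are Lipschitz only on `U`. -/

theorem isCompact_l1Ball (d : ℕ) : IsCompact (l1Ball d) := by
  refine Metric.isCompact_of_isClosed_isBounded (isClosed_le (by fun_prop) continuous_const)
    (Metric.isBounded_closedBall (x := 0) (r := 1) |>.subset fun e he => ?_)
  rw [mem_closedBall_zero_iff]
  exact (norm_le_sum_abs e).trans he

/-- Compactness of the ball makes the neighbourhood of `x` uniform in `u`. Agreement of the two
smoothings at `x` alone would say nothing about derivatives. -/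
theorem eventually_forall_l1Ball_mem {d : ℕ} {U : Set (EuclideanSpace ℝ (Fin d))} (hU : IsOpen U)
    {γ : ℝ} {x : EuclideanSpace ℝ (Fin d)} (h : ∀ u ∈ l1Ball d, x + γ • u ∈ U) :
    ∀ᶠ y in 𝓝 x, ∀ u ∈ l1Ball d, y + γ • u ∈ U := by
  refine (isCompact_l1Ball d).eventually_forall_of_forall_eventually fun u hu => ?_
  have hc : Continuous fun z : EuclideanSpace ℝ (Fin d) × EuclideanSpace ℝ (Fin d) =>
    z.1 + γ • z.2 := by fun_prop
  exact hc.continuousAt.eventually (hU.mem_nhds (h u hu))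

theorem l1Smoothing_congr {d : ℕ} {f F : EuclideanSpace ℝ (Fin d) → ℝ} {γ : ℝ}
    {y : EuclideanSpace ℝ (Fin d)} (h : ∀ u ∈ l1Ball d, f (y + γ • u) = F (y + γ • u)) :
    l1Smoothing f γ y = l1Smoothing F γ y := by
  refine integral_congr_ae ?_
  filter_upwards [ae_mem_l1Ball d] with u hu using h u hu

theorem l1GradEstimator_congr {d : ℕ} {f F : EuclideanSpace ℝ (Fin d) → ℝ} {γ : ℝ}
    {x e : EuclideanSpace ℝ (Fin d)} (h : ∀ u ∈ l1Ball d, f (x + γ • u) = F (x + γ • u))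
    (he : e ∈ l1Sphere d) : l1GradEstimator f γ x e = l1GradEstimator F γ x e := by
  have h1 : ∑ i, |e i| = 1 := he
  have h2 := h e h1.le
  have h3 := h (-e) (by simpa [l1Ball] using h1.le)
  rw [smul_neg, ← sub_eq_add_neg] at h3
  rw [l1GradEstimator, l1GradEstimator, h2, h3]

theorem theorem6 (d : ℕ) (hd : 1 ≤ d)
    (Q U : Set (EuclideanSpace ℝ (Fin d))) (hU : IsOpen U)
    (γ : ℝ) (hγ : 0 < γ)
    (hQU : ∀ x ∈ Q, ∀ u ∈ l1Ball d, x + γ • u ∈ U)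
    (f : EuclideanSpace ℝ (Fin d) → ℝ) (M₂ : ℝ≥0) (hf : LipschitzOnWith M₂ f U)
    (p q : ℝ≥0∞) (hp₁ : 1 ≤ p) (hp₂ : p ≤ 2) (hpq : 1 / p + 1 / q = 1) :
    ∀ x ∈ Q,
      (Integrable (fun e => l1GradEstimator f γ x e) (uniformL1Sphere d) ∧
        HasGradientAt (l1Smoothing f γ)
          (∫ e, l1GradEstimator f γ x e ∂(uniformL1Sphere d)) x) ∧
      (Integrable (fun e => lqNorm q (l1GradEstimator f γ x e) ^ 2) (uniformL1Sphere d) ∧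
        ∫ e, lqNorm q (l1GradEstimator f γ x e) ^ 2 ∂(uniformL1Sphere d) ≤
          288 * (d : ℝ) ^ (2 / q).toReal * (M₂ : ℝ) ^ 2) := by
  intro x hx
  obtain ⟨n, rfl⟩ : ∃ n, d = n + 1 := ⟨d - 1, by omega⟩
  -- The extension keeps the constant `M₂`, so the bound for `F` is already the one required for
  -- `f`.
  obtain ⟨F, hF, hfF⟩ := hf.extend_real
  have hq : 1 ≤ q := by
    have h1 : 1 / q ≤ 1 := le_add_self.trans_eq hpq
    rwa [one_div, ENNReal.inv_le_one] at h1
  have hxF : ∀ u ∈ l1Ball (n + 1), f (x + γ • u) = F (x + γ • u) :=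
    fun u hu => hfF (hQU x hx u hu)
  have hest : ∀ᵐ e ∂uniformL1Sphere (n + 1), l1GradEstimator f γ x e = l1GradEstimator F γ x e := by
    filter_upwards [ae_mem_l1Sphere n] with e he using l1GradEstimator_congr hxF he
  have hest2 : ∀ᵐ e ∂uniformL1Sphere (n + 1), lqNorm q (l1GradEstimator f γ x e) ^ 2 =
      lqNorm q (l1GradEstimator F γ x e) ^ 2 := by
    filter_upwards [hest] with e he
    rw [he]
  have hsm : l1Smoothing f γ =ᶠ[𝓝 x] l1Smoothing F γ := by
    filter_upwards [eventually_forall_l1Ball_mem hU (hQU x hx)] with y hy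
    exact l1Smoothing_congr fun u hu => hfF (hy u hu)
  have hmain := hF.integral_lqNorm_sq_l1GradEstimator_le hq hγ x
  rw [integral_congr_ae hest, integral_congr_ae hest2, integrable_congr hest,
    integrable_congr hest2]
  exact ⟨⟨hF.integrable_l1GradEstimator hγ x,
    (hF.hasGradientAt_l1Smoothing hγ x).congr_of_eventuallyEq hsm⟩, hmain⟩
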